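/- Consider $n\ge 2$ agents on the real line with opinions $x_t(1),\dots,x_t(n)$ at time $t=0,1,2,\dots$, starting from $x_0(i)=i$ and evolving by the Hegselmann–Krause rule with confidence bound $1$: $$x_{t+1}(i)=\frac{1}{|\mathcal N_t(i)|}\sum_{j\in\mathcal N_t(i)}x_t(j),\qquad \mathcal N_t(i)=\{j: |x_t(j)-x_t(i)|\le 1\}.$$ The receptivity graph at time $t$ has the agents as vertices, with distinct $i,j$ adjacent when $|x_t(i)-x_t(j)|\le 1$. A cluster is a maximal set of agents with equal opinions; a configuration is frozen if any two different opinions are at distance greater than $1$. Write $n=6k+l$ with $0\le l\le 5$, and put $\varepsilon(l)=l-1$ for $l\in\{2,3\}$, $\varepsilon(1)=1$, and $\varepsilon(l)=l+1$ for $l\in\{0,4,5\}$. Then: (i) After every fifth time step a group of three agents disconnects from either end of the receptivity graph and collapses to a cluster at the next step. Precisely, for each $0\le j<k$: for $5j\le t<5(j+1)$ the agents $3j+1,\dots,n-3j$ form a connected component of the receptivity graph; for all $t\ge 5(j+1)$ the three agents $3j+1,3j+2,3j+3$ form a connected component, and so do the three agents $n-3j-2,n-3j-1,n-3j$; neither of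 these two groups is a cluster at time $5(j+1)$, and both are clusters at time $5(j+1)+1$. If $l>0$, the $l$ agents $3k+1,\dots,n-3k$ form a connected component for all $t\ge 5k$. (ii) The opinions are constant from time $5k+\varepsilon(l)$ on. The clusters of this final configuration are the $2k$ groups of size $3$ from (i) and, if $l>0$, one more cluster, consisting of the $l$ central agents $3k+1,\dots,n-3k$ and having opinion $\frac{n+1}{2}$. The final opinions are distributed symmetrically about $\frac{n+1}{2}$: those of agents $i$ and $n+1-i$ add up to $n+1$. (iii) The first time at which the configuration is frozen is $t=5k+\varepsilon(l)$. -/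

import Mathlib

namespace HK

/-- The agents whose opinions lie within the confidence bound `1` of the opinion of agent `i`. -/
noncomputable def neighbors {n : ℕ} (x : Fin n → ℝ) (i : Fin n) : Finset (Fin n) :=
  Finset.univ.filter (fun j => |x j - x i| ≤ 1)

/-- One step of the Hegselmann-Krause dynamics with confidence bound `1`. -/
noncomputable def step {n : ℕ} (x : Fin n → ℝ) : Fin n → ℝ :=
  fun i => (∑ j ∈ neighbors x i, x j) / ((neighbors x i).card : ℝ)

/-- The configuration `(1, 2, ..., n)`. Agents are numbered from `0`, so that agent `i : Fin n`
has opinion `i + 1`. -/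
def equallySpaced (n : ℕ) : Fin n → ℝ := fun i => (i.val : ℝ) + 1

/-- The opinions at time `t`, starting from `(1, 2, ..., n)` at time `0`. -/
noncomputable def opinion (n t : ℕ) : Fin n → ℝ := step^[t] (equallySpaced n)

/-- The receptivity graph: distinct agents are adjacent if their opinions are at distance at
most `1`. -/
def receptivityGraph {n : ℕ} (x : Fin n → ℝ) : SimpleGraph (Fin n) where
  Adj i j := i ≠ j ∧ |x i - x j| ≤ 1
  symm := ⟨fun i j h => ⟨h.1.symm, by rw [abs_sub_comm]; exact h.2⟩⟩
  loopless := ⟨fun _ h => h.1 rfl⟩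

/-- `S` is the set of agents of a connected component of the receptivity graph. -/
def IsComponent {n : ℕ} (x : Fin n → ℝ) (S : Finset (Fin n)) : Prop :=
  ∃ c : (receptivityGraph x).ConnectedComponent, c.supp = (S : Set (Fin n))

/-- A cluster is a maximal set of agents that agree. -/
def IsCluster {n : ℕ} (x : Fin n → ℝ) (S : Finset (Fin n)) : Prop :=
  Maximal (fun A : Finset (Fin n) => ∀ i ∈ A, ∀ j ∈ A, x i = x j) S

/-- A configuration is frozen if any two different opinions are at distance greater than `1`. -/
def Frozen {n : ℕ} (x : Fin n → ℝ) : Prop :=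
  ∀ i j, x i ≠ x j → 1 < |x i - x j|

/-- The agents `i` with `a ≤ i < b`. -/
def block (n a b : ℕ) : Finset (Fin n) :=
  Finset.univ.filter (fun i => a ≤ i.val ∧ i.val < b)

/-- The `j`-th group of three agents counted from the left end, `j = 0, 1, ...`. -/
def leftTriple (n j : ℕ) : Finset (Fin n) := block n (3 * j) (3 * j + 3)

/-- The `j`-th group of three agents counted from the right end, `j = 0, 1, ...`; used for
`3 * j + 3 ≤ n` only. -/
def rightTriple (n j : ℕ) : Finset (Fin n) := block n (n - (3 * j + 3)) (n - 3 * j)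

/-- The agents that are left when `j` groups of three are removed at each end; used for
`6 * j ≤ n` only. -/
def middle (n j : ℕ) : Finset (Fin n) := block n (3 * j) (n - 3 * j)

/-- The first `k` groups of three at the left end and the first `k` at the right end. -/
def endTriples (n k : ℕ) : Finset (Finset (Fin n)) :=
  (Finset.range k).image (leftTriple n) ∪ (Finset.range k).image (rightTriple n)

/-- The correction `ε(l)` to the freezing time, for `0 ≤ l ≤ 5`. -/
def eps (l : ℕ) : ℕ :=
  if l = 2 ∨ l = 3 then l - 1 else if l = 1 then l else l + 1

end HK

/-!
The argument follows the gaps between consecutive opinions. Sortedness and the reflection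
`i ↦ n + 1 - i` are preserved by the dynamics (`regular_opinion`), and a gap greater than `1` never
closes again (`Cut.step`), so that groups once separated evolve independently.

As long as all gaps of a separated block are at most `1` and agents at distance two in the order do
not interact, a step replaces each gap by the average of itself and its two neighbours, and the
first gap `g 1` by `(g 1 + 2 * g 2) / 6` (`Chain.gap_step_left`, `Chain.gap_step_inner`). This map is
linear and monotone in the gaps. Starting from gaps `1`, the chain keeps this form for four steps;
then the outermost three agents at either end interact with each other, and the fifth step cuts
them off (`Phase.one_lt_gap`), after which they collapse. The gaps of the remaining agents are
averages of gaps from further inside the chain, hence almost `1` again, and the process repeats with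
six agents fewer.

To see that the deviations do not pile up, the gap `i` of a block of `m` agents, `s` steps after a
shedding, is enclosed between `lower s i + lower s (m - i) - 1` and `upper s i`, where `lower` and
`upper` solve the linear recursion of a one-sided infinite chain. Superposing the perturbations from
both ends is legitimate because the true recursion at the far end is more favourable than the
one-sided one (`Chain.gapBounds_step`). The lower profile starts from deviations `1 / (4 * 5 ^ i)`,
and a whole period reproduces it: the average of `lower 4` at `i + 2`, `i + 3`, `i + 4` is at least
`lower 0 i` (`lower_zero_le_average`). By monotonicity, who interacts with whom is settled by a few
numerical values of the profiles (`three_lt_lower`, `upper_four_add_le`), uniformly in `m ≥ 6`.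

After `5 * k` steps the central `l ≤ 5` agents are left, with gaps close enough to `1` to be followed
explicitly up to their collapse (`Phase.collapses`). A frozen configuration is stationary, so for the
freezing time it suffices to exhibit a gap in `(0, 1]` one step before the claimed time.
-/

namespace HK

/-! ### Order and reflection -/

theorem mem_neighbors {n : ℕ} {x : Fin n → ℝ} {i j : Fin n} :
    j ∈ neighbors x i ↔ |x j - x i| ≤ 1 := by
  simp [neighbors]

theorem mem_block {n a b : ℕ} {i : Fin n} : i ∈ block n a b ↔ a ≤ i.val ∧ i.val < b := by
  simp [block]

theorem self_mem_neighbors {n : ℕ} (x : Fin n → ℝ) (i : Fin n) : i ∈ neighbors x i := by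
  simp [mem_neighbors]

theorem card_neighbors_pos {n : ℕ} (x : Fin n → ℝ) (i : Fin n) :
    (0 : ℝ) < (neighbors x i).card := by
  exact_mod_cast Finset.card_pos.2 ⟨i, self_mem_neighbors x i⟩

theorem step_le {n : ℕ} {x : Fin n → ℝ} {i : Fin n} {c : ℝ}
    (h : ∀ j ∈ neighbors x i, x j ≤ c) : step x i ≤ c := by
  rw [step, div_le_iff₀ (card_neighbors_pos x i)]
  simpa [mul_comm] using Finset.sum_le_card_nsmul _ _ _ h

theorem le_step {n : ℕ} {x : Fin n → ℝ} {i : Fin n} {c : ℝ}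
    (h : ∀ j ∈ neighbors x i, c ≤ x j) : c ≤ step x i := by
  rw [step, le_div_iff₀ (card_neighbors_pos x i)]
  simpa [mul_comm] using Finset.card_nsmul_le_sum _ _ _ h

/-- The average over `A` is at most the average over `B` if the members of `A` outside `B` lie
below all of `B` and the members of `B` outside `A` lie above all of `A`. -/
theorem average_le_average {ι : Type*} [DecidableEq ι] {A B : Finset ι} {f : ι → ℝ}
    (hA : A.Nonempty) (hB : B.Nonempty)
    (h₁ : ∀ a ∈ A, a ∉ B → ∀ b ∈ B, f a ≤ f b) (h₂ : ∀ b ∈ B, b ∉ A → ∀ a ∈ A, f a ≤ f b) :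
    (∑ a ∈ A, f a) / A.card ≤ (∑ b ∈ B, f b) / B.card := by
  have hA' : (0 : ℝ) < A.card := by exact_mod_cast hA.card_pos
  have hB' : (0 : ℝ) < B.card := by exact_mod_cast hB.card_pos
  rw [div_le_div_iff₀ hA' hB']
  have hsum : ∑ a ∈ A, ∑ b ∈ B, (f b - f a) =
      (∑ b ∈ B, f b) * A.card - (∑ a ∈ A, f a) * B.card := by
    simp only [Finset.sum_sub_distrib, Finset.sum_const, nsmul_eq_mul, ← Finset.mul_sum]
    ring
  have hswap : ∑ a ∈ A ∩ B, ∑ b ∈ A ∩ B, (f b - f a) = 0 := by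
    simp only [Finset.sum_sub_distrib, Finset.sum_const, nsmul_eq_mul, ← Finset.mul_sum]
    ring
  -- the pairs inside `A ∩ B` cancel, the other ones contribute nonnegatively
  have hpos : ∑ a ∈ A ∩ B, ∑ b ∈ A ∩ B, (f b - f a) ≤ ∑ a ∈ A, ∑ b ∈ B, (f b - f a) := by
    rw [← Finset.sum_product', ← Finset.sum_product']
    apply Finset.sum_le_sum_of_subset_of_nonneg
    · exact Finset.product_subset_product Finset.inter_subset_left Finset.inter_subset_right
    · rintro ⟨a, b⟩ hab hab'
      simp only [Finset.mem_product, Finset.mem_inter] at hab hab'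
      by_cases ha : a ∈ B
      · have hb : b ∉ A := fun hb => hab' ⟨⟨hab.1, ha⟩, hb, hab.2⟩
        exact sub_nonneg.2 (h₂ b hab.2 hb a hab.1)
      · exact sub_nonneg.2 (h₁ a hab.1 ha b hab.2)
  linarith

/-- A configuration that is sorted and symmetric about `(n + 1) / 2`. -/
structure Regular {n : ℕ} (x : Fin n → ℝ) : Prop where
  mono : Monotone x
  symm : ∀ i, x i + x i.rev = n + 1

/-- The order of the agents is preserved: the neighbours of `i` that `j ≥ i` lacks lie below all
neighbours of `j`, and vice versa. -/
theorem step_mono {n : ℕ} {x : Fin n → ℝ} (hx : Monotone x) : Monotone (step x) := by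
  intro i j hij
  have hij' := hx hij
  apply average_le_average ⟨i, self_mem_neighbors x i⟩ ⟨j, self_mem_neighbors x j⟩
  · intro a ha ha' b hb
    rw [mem_neighbors, abs_le] at ha hb ha'
    by_contra! h
    exact ha' ⟨by linarith, by linarith⟩
  · intro b hb hb' a ha
    rw [mem_neighbors, abs_le] at ha hb hb'
    by_contra! h
    exact hb' ⟨by linarith, by linarith⟩

theorem neighbors_rev {n : ℕ} {x : Fin n → ℝ} (hx : ∀ i, x i + x i.rev = n + 1) (i : Fin n) :
    neighbors x i.rev = (neighbors x i).map Fin.revPerm.toEmbedding := by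
  ext j
  simp only [Finset.mem_map_equiv, mem_neighbors, Fin.revPerm_symm, Fin.revPerm_apply]
  have h₁ := hx i
  have h₂ := hx j
  rw [show x j - x i.rev = -(x j.rev - x i) by linarith, abs_neg]

theorem step_symm {n : ℕ} {x : Fin n → ℝ} (hx : ∀ i, x i + x i.rev = n + 1) (i : Fin n) :
    step x i + step x i.rev = n + 1 := by
  have hc := card_neighbors_pos x i
  unfold step
  rw [neighbors_rev hx, Finset.card_map, Finset.sum_map, ← add_div, ← Finset.sum_add_distrib,
    div_eq_iff hc.ne']
  simp only [Equiv.coe_toEmbedding, Fin.revPerm_apply, hx, Finset.sum_const, nsmul_eq_mul]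
  ring

theorem Regular.step {n : ℕ} {x : Fin n → ℝ} (hx : Regular x) : Regular (step x) :=
  ⟨step_mono hx.mono, step_symm hx.symm⟩

theorem opinion_succ (n t : ℕ) : opinion n (t + 1) = step (opinion n t) :=
  Function.iterate_succ_apply' _ _ _

theorem regular_opinion (n t : ℕ) : Regular (opinion n t) := by
  induction t with
  | zero =>
    refine ⟨fun i j hij => ?_, fun i => ?_⟩
    · simpa [opinion, equallySpaced] using hij
    · have h : (i.rev : ℕ) + (i.val + 1) = n := by rw [Fin.val_rev]; omega
      have h' : ((i.rev : ℕ) : ℝ) + (i.val + 1) = n := by exact_mod_cast h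
      simp only [opinion, equallySpaced, Function.iterate_zero, id_eq]
      linarith
  | succ t ih => rw [opinion_succ]; exact ih.step

/-! ### Gaps and cuts -/

/-- The opinion of the agent with number `i`, with value `0` if there is no such agent. -/
noncomputable def val {n : ℕ} (x : Fin n → ℝ) (i : ℕ) : ℝ := if h : i < n then x ⟨i, h⟩ else 0

/-- The gap between the agents `p - 1` and `p`; used for `0 < p < n` only. -/
noncomputable def gap {n : ℕ} (x : Fin n → ℝ) (p : ℕ) : ℝ := val x p - val x (p - 1)

/-- No agent below `p` interacts with an agent from `p` on, at least when the configuration is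
sorted. -/
def Cut {n : ℕ} (x : Fin n → ℝ) (p : ℕ) : Prop := p = 0 ∨ p = n ∨ 1 < gap x p

theorem val_fin {n : ℕ} (x : Fin n → ℝ) (i : Fin n) : val x i = x i := by simp [val]

theorem val_of_lt {n : ℕ} (x : Fin n → ℝ) {i : ℕ} (h : i < n) : val x i = x ⟨i, h⟩ := by
  simp [val, h]

theorem val_mono {n : ℕ} {x : Fin n → ℝ} (hx : Monotone x) {i j : ℕ} (hij : i ≤ j) (hj : j < n) :
    val x i ≤ val x j := by
  rw [val_of_lt x hj, val_of_lt x (hij.trans_lt hj)]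
  exact hx hij

theorem gap_nonneg {n : ℕ} {x : Fin n → ℝ} (hx : Monotone x) {p : ℕ} (hp : p < n) :
    0 ≤ gap x p :=
  sub_nonneg.2 (val_mono hx (Nat.sub_le _ _) hp)

theorem val_symm {n : ℕ} {x : Fin n → ℝ} (hx : Regular x) {i j : ℕ} (hij : i + j + 1 = n) :
    val x i + val x j = n + 1 := by
  rw [val_of_lt x (by omega : i < n), val_of_lt x (by omega : j < n), ← hx.symm ⟨i, by omega⟩]
  congr 2
  ext
  simp only [Fin.val_rev]
  omega

theorem gap_symm {n : ℕ} {x : Fin n → ℝ} (hx : Regular x) {p q : ℕ} (hp : 0 < p) (hq : 0 < q)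
    (hpq : p + q = n) : gap x p = gap x q := by
  have h₁ := val_symm hx (i := p) (j := q - 1) (by omega)
  have h₂ := val_symm hx (i := p - 1) (j := q) (by omega)
  unfold gap
  linarith

theorem Cut.symm {n : ℕ} {x : Fin n → ℝ} (hx : Regular x) {p q : ℕ} (hpq : p + q = n)
    (h : Cut x p) : Cut x q := by
  by_cases hp : p = 0
  · exact .inr (.inl (by omega))
  by_cases hq : q = 0
  · exact .inl hq
  rcases h with h | h | h
  · omega
  · omega
  · exact .inr (.inr (by rwa [← gap_symm hx (by omega) (by omega) hpq]))

theorem Cut.lt {n : ℕ} {x : Fin n → ℝ} (hx : Monotone x) {p : ℕ} (h : Cut x p) {i j : Fin n}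
    (hi : i.val < p) (hj : p ≤ j.val) : 1 < x j - x i := by
  have hjn := j.isLt
  rcases h with h | h | h
  · omega
  · omega
  · have h₁ := val_mono hx (i := i) (j := p - 1) (by omega) (by omega)
    have h₂ := val_mono hx hj hjn
    rw [val_fin] at h₁ h₂
    unfold gap at h
    linarith

/-- A cut persists, since the agents next to it can only move away from it. -/
theorem Cut.step {n : ℕ} {x : Fin n → ℝ} (hx : Monotone x) {p : ℕ} (hpn : p ≤ n) (h : Cut x p) :
    Cut (step x) p := by
  have h' := h
  rcases h with h | h | h
  · exact .inl h
  · exact .inr (.inl h)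
  by_cases hp : p = 0
  · exact .inl hp
  by_cases hp' : p = n
  · exact .inr (.inl hp')
  refine .inr (.inr ?_)
  unfold gap at h ⊢
  rw [val_of_lt _ (by omega : p < n), val_of_lt _ (by omega : p - 1 < n)] at h ⊢
  have h₁ : HK.step x ⟨p - 1, by omega⟩ ≤ x ⟨p - 1, by omega⟩ := by
    apply step_le
    intro j hj
    rw [mem_neighbors, abs_le] at hj
    rcases lt_or_ge j.val p with hjp | hjp
    · exact hx (Fin.mk_le_mk.2 (by omega) : j ≤ ⟨p - 1, by omega⟩)
    · have := h'.lt hx (i := ⟨p - 1, by omega⟩) (by simp; omega) hjp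
      linarith
  have h₂ : x ⟨p, by omega⟩ ≤ HK.step x ⟨p, by omega⟩ := by
    apply le_step
    intro j hj
    rw [mem_neighbors, abs_le] at hj
    rcases lt_or_ge j.val p with hjp | hjp
    · have := h'.lt hx (j := ⟨p, by omega⟩) hjp le_rfl
      linarith
    · exact hx (Fin.mk_le_mk.2 hjp : (⟨p, by omega⟩ : Fin n) ≤ j)
  linarith

theorem Cut.opinion {n t t' p : ℕ} (htt : t ≤ t') (hpn : p ≤ n) (h : Cut (opinion n t) p) :
    Cut (opinion n t') p := by
  induction t', htt using Nat.le_induction with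
  | base => exact h
  | succ t' _ ih => rw [opinion_succ]; exact ih.step (regular_opinion n t').mono hpn

/-! ### One step of the dynamics -/

/-- The neighbours of an agent in a sorted configuration form a block. -/
theorem neighbors_eq_block {n : ℕ} {x : Fin n → ℝ} (hx : Monotone x) {p q i : ℕ} (hpi : p ≤ i)
    (hiq : i < q) (hqn : q ≤ n) (h₁ : val x i - val x p ≤ 1) (h₂ : val x (q - 1) - val x i ≤ 1)
    (h₃ : Cut x p ∨ 1 < val x i - val x (p - 1)) (h₄ : Cut x q ∨ 1 < val x q - val x i) :
    neighbors x ⟨i, hiq.trans_le hqn⟩ = block n p q := by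
  ext j
  have hj := j.isLt
  rw [mem_neighbors, mem_block, abs_le, ← val_fin x j, ← val_of_lt x (hiq.trans_le hqn)]
  constructor
  · rintro ⟨ha, hb⟩
    constructor
    · by_contra! hjp
      rcases h₃ with h | h
      · have := h.lt hx hjp (j := ⟨i, by omega⟩) hpi
        rw [← val_fin x j, ← val_of_lt x (by omega : i < n)] at this
        linarith
      · have := val_mono hx (i := j) (j := p - 1) (by omega) (by omega)
        linarith
    · by_contra! hjq
      rcases h₄ with h | h
      · have := h.lt hx (i := ⟨i, by omega⟩) hiq hjq
        rw [← val_fin x j, ← val_of_lt x (by omega : i < n)] at this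
        linarith
      · have := val_mono hx hjq hj
        linarith
  · rintro ⟨ha, hb⟩
    have := val_mono hx ha hj
    have := val_mono hx (i := j) (j := q - 1) (by omega) (by omega)
    constructor <;> linarith

theorem sum_block {n : ℕ} (x : Fin n → ℝ) {p c : ℕ} (h : p + c ≤ n) :
    ∑ j ∈ block n p (p + c), x j = ∑ i ∈ Finset.range c, val x (p + i) := by
  symm
  refine Finset.sum_bij (fun i hi => ⟨p + i, by rw [Finset.mem_range] at hi; omega⟩) ?_ ?_ ?_ ?_
  · intro i hi
    rw [Finset.mem_range] at hi
    simpa [mem_block] using hi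
  · intro i _ j _ hij
    simpa using hij
  · intro j hj
    rw [mem_block] at hj
    exact ⟨j - p, by rw [Finset.mem_range]; omega, by ext; simp; omega⟩
  · intro i hi
    exact val_of_lt x _

theorem card_block {n p q : ℕ} (h : q ≤ n) : (block n p q).card = q - p := by
  rw [← Nat.card_Ico, ← Finset.card_map Fin.valEmbedding]
  congr 1
  ext i
  simp only [Finset.mem_map, mem_block, Fin.valEmbedding_apply, Finset.mem_Ico]
  exact ⟨fun ⟨j, hj, hji⟩ => hji ▸ hj, fun hi => ⟨⟨i, by omega⟩, hi, rfl⟩⟩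

/-- An agent whose neighbours are the `c` agents from `p` on moves to the average of their
opinions. -/
theorem val_step {n : ℕ} {x : Fin n → ℝ} (hx : Monotone x) {i : ℕ} (p c : ℕ) (hpi : p ≤ i)
    (hiq : i < p + c) (hqn : p + c ≤ n) (h₁ : val x i - val x p ≤ 1)
    (h₂ : val x (p + c - 1) - val x i ≤ 1) (h₃ : Cut x p ∨ 1 < val x i - val x (p - 1))
    (h₄ : Cut x (p + c) ∨ 1 < val x (p + c) - val x i) :
    val (step x) i = (∑ r ∈ Finset.range c, val x (p + r)) / c := by
  rw [val_of_lt _ (hiq.trans_le hqn), step, neighbors_eq_block hx hpi hiq hqn h₁ h₂ h₃ h₄,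
    sum_block x hqn, card_block hqn]
  simp

/-! ### Components and clusters between two cuts -/

theorem isComponent_block {n : ℕ} {x : Fin n → ℝ} (hx : Monotone x) {a b : ℕ} (hab : a < b)
    (hbn : b ≤ n) (ha : Cut x a) (hb : Cut x b) (hgap : ∀ p, a < p → p < b → gap x p ≤ 1) :
    IsComponent x (block n a b) := by
  have han : a < n := hab.trans_le hbn
  refine ⟨(receptivityGraph x).connectedComponentMk ⟨a, han⟩, ?_⟩
  have hclosed : ∀ i j : Fin n, (receptivityGraph x).Adj i j → i ∈ block n a b →
      j ∈ block n a b := by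
    rintro i j ⟨-, hij⟩ hi
    rw [mem_block] at hi ⊢
    rw [abs_le] at hij
    constructor
    · by_contra! h
      have := ha.lt hx h hi.1
      linarith
    · by_contra! h
      have := hb.lt hx hi.2 h
      linarith
  ext v
  rw [SimpleGraph.ConnectedComponent.mem_supp_iff, SimpleGraph.ConnectedComponent.eq,
    Finset.mem_coe]
  constructor
  · intro h
    obtain ⟨w⟩ := h.symm
    have : ∀ i j : Fin n, (receptivityGraph x).Walk i j → i ∈ block n a b → j ∈ block n a b := by
      intro i j w
      induction w with
      | nil => exact id
      | cons h _ ih => exact fun hi => ih (hclosed _ _ h hi)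
    exact this _ _ w (mem_block.2 ⟨le_rfl, hab⟩)
  · intro hv
    rw [mem_block] at hv
    have : ∀ i, a ≤ i → ∀ h : i < b,
        (receptivityGraph x).Reachable ⟨i, h.trans_le hbn⟩ ⟨a, han⟩ := by
      intro i hi
      induction i, hi using Nat.le_induction with
      | base => exact fun _ => SimpleGraph.Reachable.refl _
      | succ i hi ih =>
        intro h
        refine SimpleGraph.Reachable.trans (SimpleGraph.Adj.reachable ?_) (ih (by omega))
        refine ⟨by simp, ?_⟩
        have h₁ := hgap (i + 1) (by omega) h
        have h₂ := gap_nonneg hx (p := i + 1) (by omega)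
        rw [gap, Nat.add_sub_cancel, val_of_lt x (by omega : i + 1 < n),
          val_of_lt x (by omega : i < n)] at h₁ h₂
        rw [abs_le]
        constructor <;> linarith
    exact this v hv.1 hv.2

/-- All agents in `S` have the same opinion. -/
def AgreeOn {n : ℕ} (x : Fin n → ℝ) (S : Finset (Fin n)) : Prop := ∀ i ∈ S, ∀ j ∈ S, x i = x j

theorem AgreeOn.gap_eq_zero {n : ℕ} {x : Fin n → ℝ} {a b p : ℕ} (hbn : b ≤ n)
    (h : AgreeOn x (block n a b)) (hap : a < p) (hpb : p < b) : gap x p = 0 := by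
  rw [gap, val_of_lt x (by omega : p < n), val_of_lt x (by omega : p - 1 < n), sub_eq_zero]
  exact h _ (by simp [mem_block]; omega) _ (by simp [mem_block]; omega)

theorem isCluster_block {n : ℕ} {x : Fin n → ℝ} (hx : Monotone x) {a b : ℕ} (hab : a < b)
    (hbn : b ≤ n) (ha : Cut x a) (hb : Cut x b) (h : AgreeOn x (block n a b)) :
    IsCluster x (block n a b) := by
  refine ⟨h, fun A hA hBA i hi => ?_⟩
  have h₀ : (⟨a, hab.trans_le hbn⟩ : Fin n) ∈ A := hBA (mem_block.2 ⟨le_rfl, hab⟩)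
  have h₁ := hA i hi _ h₀
  rw [mem_block]
  constructor
  · by_contra! hia
    have := ha.lt hx hia (j := ⟨a, hab.trans_le hbn⟩) le_rfl
    linarith
  · by_contra! hib
    have := hb.lt hx (i := ⟨a, hab.trans_le hbn⟩) hab hib
    linarith

theorem IsCluster.eq_of_mem {n : ℕ} {x : Fin n → ℝ} {S T : Finset (Fin n)} (hS : IsCluster x S)
    (hT : IsCluster x T) {i : Fin n} (hiS : i ∈ S) (hiT : i ∈ T) : S = T := by
  have h : ∀ j ∈ S ∪ T, x j = x i := fun j hj =>
    (Finset.mem_union.1 hj).elim (fun hj => hS.1 j hj i hiS) (fun hj => hT.1 j hj i hiT)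
  have h' : ∀ j ∈ S ∪ T, ∀ k ∈ S ∪ T, x j = x k := fun j hj k hk => (h j hj).trans (h k hk).symm
  exact (hS.eq_of_le h' Finset.subset_union_left).trans
    (hT.eq_of_le h' Finset.subset_union_right).symm

theorem IsCluster.nonempty {n : ℕ} (hn : 0 < n) {x : Fin n → ℝ} {S : Finset (Fin n)}
    (hS : IsCluster x S) : S.Nonempty := by
  by_contra! h
  subst h
  have := hS.2 (y := {⟨0, hn⟩}) (by simp) (Finset.empty_subset _)
  simpa using this (Finset.mem_singleton_self _)

/-- A group cut off on both sides and of diameter at most `1` agrees after one step. -/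
theorem collapse {n : ℕ} {x : Fin n → ℝ} (hx : Monotone x) {a b : ℕ}
    (hbn : b ≤ n) (ha : Cut x a) (hb : Cut x b) (h : val x (b - 1) - val x a ≤ 1) :
    AgreeOn (step x) (block n a b) := by
  have key : ∀ i ∈ block n a b, neighbors x i = block n a b := by
    intro i hi
    rw [mem_block] at hi
    have h₁ := val_mono hx hi.1 i.isLt
    have h₂ := val_mono hx (i := i) (j := b - 1) (by omega) (by omega)
    exact neighbors_eq_block hx hi.1 hi.2 hbn (by linarith) (by linarith) (.inl ha) (.inl hb)
  intro i hi j hj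
  rw [step, step, key i hi, key j hj]

theorem AgreeOn.step {n : ℕ} {x : Fin n → ℝ} (hx : Monotone x) {a b : ℕ}
    (hbn : b ≤ n) (ha : Cut x a) (hb : Cut x b) (h : AgreeOn x (block n a b)) :
    AgreeOn (step x) (block n a b) := by
  by_cases hab : a < b
  · apply collapse hx hbn ha hb
    rw [val_of_lt x (by omega : b - 1 < n), val_of_lt x (by omega : a < n),
      h _ (by simp [mem_block]; omega) ⟨a, by omega⟩ (by simp [mem_block]; omega)]
    simp
  · intro i hi
    rw [mem_block] at hi
    omega

theorem AgreeOn.opinion {n t t' a b : ℕ} (htt : t ≤ t') (hab : a ≤ b) (hbn : b ≤ n)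
    (ha : Cut (opinion n t) a)
    (hb : Cut (opinion n t) b) (h : AgreeOn (opinion n t) (block n a b)) :
    AgreeOn (opinion n t') (block n a b) := by
  induction t', htt using Nat.le_induction with
  | base => exact h
  | succ t' htt' ih =>
    rw [opinion_succ]
    exact ih.step (regular_opinion n t').mono hbn (ha.opinion htt' (hab.trans hbn))
      (hb.opinion htt' hbn)

/-! ### Frozen configurations -/

theorem Frozen.step_eq {n : ℕ} {x : Fin n → ℝ} (h : Frozen x) : step x = x := by
  have key : ∀ i, ∀ j ∈ neighbors x i, x j = x i := by
    intro i j hj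
    by_contra hij
    have := h j i hij
    rw [mem_neighbors] at hj
    linarith
  ext i
  exact le_antisymm (step_le fun j hj => (key i j hj).le) (le_step fun j hj => (key i j hj).ge)

theorem Frozen.opinion_eq {n t t' : ℕ} (h : Frozen (opinion n t)) (htt : t ≤ t') :
    opinion n t' = opinion n t := by
  induction t', htt using Nat.le_induction with
  | base => rfl
  | succ t' _ ih => rw [opinion_succ, ih, h.step_eq]

theorem not_frozen_of_gap {n : ℕ} {x : Fin n → ℝ} {p : ℕ} (hpn : p < n) (h₀ : 0 < gap x p)
    (h₁ : gap x p ≤ 1) : ¬ Frozen x := by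
  intro h
  rw [gap, val_of_lt x hpn, val_of_lt x (by omega : p - 1 < n)] at h₀ h₁
  have := h ⟨p, hpn⟩ ⟨p - 1, by omega⟩ (by intro h; rw [h] at h₀; simp at h₀)
  rw [abs_of_pos h₀] at this
  linarith

/-! ### Chains -/

/-- The agents from `a` to `a + m - 1` do not interact with the others, and the agents among them
that interact are exactly the consecutive ones. The cut at the right end follows from the one at the
left end by symmetry. -/
structure Chain {n : ℕ} (x : Fin n → ℝ) (a m : ℕ) : Prop where
  reg : Regular x
  size : a + m + a = n
  cut : Cut x a
  gap_le : ∀ i, 1 ≤ i → i < m → gap x (a + i) ≤ 1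
  lt_gap_add : ∀ i, 1 ≤ i → i + 1 < m → 1 < gap x (a + i) + gap x (a + i + 1)

theorem Chain.val_step_left {n : ℕ} {x : Fin n → ℝ} {a m : ℕ} (h : Chain x a m) (hm : 2 ≤ m) :
    val (step x) a = (val x a + val x (a + 1)) / 2 := by
  have hn := h.size
  have h₁ := h.gap_le 1 le_rfl (by omega)
  rw [val_step h.reg.mono a 2 le_rfl (by omega) (by omega) (by simp)
    (by simpa [gap] using h₁) (.inl h.cut)]
  · simp [Finset.sum_range_succ]
  · by_cases hm' : m = 2
    · subst hm'
      exact .inl (h.cut.symm h.reg (by omega))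
    · have h₂ := h.lt_gap_add 1 le_rfl (by omega)
      simp only [gap, Nat.add_sub_cancel] at h₂
      right
      rw [show a + 2 = a + 1 + 1 by omega]
      linarith

theorem Chain.val_step_inner {n : ℕ} {x : Fin n → ℝ} {a m : ℕ} (h : Chain x a m) {i : ℕ}
    (hi : i + 2 < m) :
    val (step x) (a + i + 1) = (val x (a + i) + val x (a + i + 1) + val x (a + i + 2)) / 3 := by
  have hn := h.size
  have h₁ := h.gap_le (i + 1) (by omega) (by omega)
  have h₂ := h.gap_le (i + 2) (by omega) (by omega)
  have e : a + i + 2 - 1 = a + i + 1 := rfl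
  simp only [gap, ← add_assoc, e, Nat.add_sub_cancel] at h₁ h₂
  rw [val_step h.reg.mono (a + i) 3 (by omega) (by omega) (by omega) h₁ (by simpa using h₂)]
  · simp [Finset.sum_range_succ, add_assoc]
  · by_cases hi' : i = 0
    · subst hi'
      exact .inl h.cut
    · right
      obtain ⟨i, rfl⟩ := Nat.exists_eq_succ_of_ne_zero hi'
      have h₃ := h.lt_gap_add (i + 1) (by omega) (by omega)
      simp only [gap, ← add_assoc, Nat.add_sub_cancel, Nat.succ_eq_add_one] at h₃ ⊢
      linarith
  · by_cases hi' : i + 3 = m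
    · exact .inl (h.cut.symm h.reg (by omega))
    · right
      have h₃ := h.lt_gap_add (i + 2) (by omega) (by omega)
      simp only [gap, ← add_assoc, e, Nat.add_sub_cancel] at h₃
      rw [show a + i + 3 = a + i + 2 + 1 by omega]
      linarith

theorem Chain.gap_step_left {n : ℕ} {x : Fin n → ℝ} {a m : ℕ} (h : Chain x a m) (hm : 3 ≤ m) :
    gap (step x) (a + 1) = (gap x (a + 1) + 2 * gap x (a + 2)) / 6 := by
  have h₁ := h.val_step_left (by omega)
  have h₂ := h.val_step_inner (i := 0) (by omega)
  simp only [gap, Nat.add_sub_cancel, add_zero] at h₂ ⊢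
  rw [h₁, h₂, show a + 2 - 1 = a + 1 by omega]
  ring

theorem Chain.gap_step_inner {n : ℕ} {x : Fin n → ℝ} {a m : ℕ} (h : Chain x a m) {i : ℕ}
    (hi : i + 3 < m) : gap (step x) (a + (i + 2)) =
      (gap x (a + (i + 1)) + gap x (a + (i + 2)) + gap x (a + (i + 3))) / 3 := by
  have h₁ := h.val_step_inner (i := i) (by omega)
  have h₂ := h.val_step_inner (i := i + 1) (by omega)
  have e : a + i + 2 - 1 = a + i + 1 := rfl
  have e' : a + i + 3 - 1 = a + i + 2 := rfl
  have e₁ : a + i + 1 + 1 = a + i + 2 := rfl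
  have e₂ : a + i + 1 + 2 = a + i + 3 := rfl
  simp only [gap, ← add_assoc, e, e', e₁, e₂, Nat.add_sub_cancel] at h₁ h₂ ⊢
  rw [h₁, h₂]
  ring

/-! ### Gap profiles -/

/-- The effect of one step on the sequence of gaps `g 1, g 2, ...` of a chain that is infinite to
the right. The value `g 0` carries no information. -/
noncomputable def evolve (g : ℕ → ℝ) : ℕ → ℝ
  | 0 => g 0
  | 1 => (g 1 + 2 * g 2) / 6
  | i + 2 => (g (i + 1) + g (i + 2) + g (i + 3)) / 3

/-- A nondecreasing sequence of gaps between `0` and `1`. -/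
structure IsProfile (g : ℕ → ℝ) : Prop where
  nonneg : ∀ i, 1 ≤ i → 0 ≤ g i
  le_one : ∀ i, 1 ≤ i → g i ≤ 1
  le_succ : ∀ i, 1 ≤ i → g i ≤ g (i + 1)

theorem IsProfile.mono {g : ℕ → ℝ} (h : IsProfile g) {i j : ℕ} (hi : 1 ≤ i) (hij : i ≤ j) :
    g i ≤ g j := by
  induction j, hij using Nat.le_induction with
  | base => rfl
  | succ j hj ih => exact ih.trans (h.le_succ j (hi.trans hj))

theorem IsProfile.evolve {g : ℕ → ℝ} (h : IsProfile g) : IsProfile (evolve g) := by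
  refine ⟨?_, ?_, ?_⟩
  · rintro (_ | _ | i) hi
    · omega
    · have := h.nonneg 1 le_rfl
      have := h.nonneg 2 (by omega)
      simp only [HK.evolve]
      linarith
    · have := h.nonneg (i + 1) (by omega)
      have := h.nonneg (i + 2) (by omega)
      have := h.nonneg (i + 3) (by omega)
      simp only [HK.evolve]
      linarith
  · rintro (_ | _ | i) hi
    · omega
    · have := h.le_one 1 le_rfl
      have := h.le_one 2 (by omega)
      simp only [HK.evolve]
      linarith
    · have := h.le_one (i + 1) (by omega)
      have := h.le_one (i + 2) (by omega)
      have := h.le_one (i + 3) (by omega)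
      simp only [HK.evolve]
      linarith
  · rintro (_ | _ | i) hi
    · omega
    · have := h.nonneg 1 le_rfl
      have := h.nonneg 3 (by omega)
      simp only [HK.evolve]
      linarith
    · have := h.le_succ (i + 1) (by omega)
      have := h.le_succ (i + 2) (by omega)
      have := h.le_succ (i + 3) (by omega)
      simp only [HK.evolve]
      linarith

/-- The lower profile `s` steps after a shedding: `1 - lower 0` majorizes the perturbation that the
shedding of triples at one end leaves in the rest of the chain. The geometric ansatz at `s = 0` is
large enough to survive a period (`lower_zero_le_average`) and small enough for the strict
inequalities that determine who interacts with whom (`three_lt_lower`, `Phase.one_lt_gap`). -/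
noncomputable def lower (s : ℕ) : ℕ → ℝ := evolve^[s] fun i => 1 - 1 / (4 * 5 ^ i)

/-- The upper profile `s` steps after a shedding: the gaps at the end of an unperturbed chain. -/
noncomputable def upper (s : ℕ) : ℕ → ℝ := evolve^[s] fun _ => 1

theorem lower_succ (s : ℕ) : lower (s + 1) = evolve (lower s) := Function.iterate_succ_apply' _ _ _

theorem upper_succ (s : ℕ) : upper (s + 1) = evolve (upper s) := Function.iterate_succ_apply' _ _ _

theorem isProfile_lower (s : ℕ) : IsProfile (lower s) := by
  induction s with
  | zero =>
    have h : ∀ i : ℕ, (0 : ℝ) < 1 / (4 * 5 ^ i) := fun i => by positivity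
    have h' : ∀ i : ℕ, (1 : ℝ) / (4 * 5 ^ (i + 1)) = 1 / (4 * 5 ^ i) / 5 := fun i => by
      rw [pow_succ]; field_simp
    have h'' : ∀ i : ℕ, (1 : ℝ) / (4 * 5 ^ i) ≤ 1 := fun i => by
      rw [div_le_one (by positivity)]
      have : (1 : ℝ) ≤ 5 ^ i := one_le_pow₀ (by norm_num)
      linarith
    refine ⟨fun i _ => ?_, fun i _ => ?_, fun i _ => ?_⟩ <;>
      simp only [lower, Function.iterate_zero, id_eq]
    · linarith [h'' i]
    · linarith [h i]
    · linarith [h i, h' i]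
  | succ s ih => rw [lower_succ]; exact ih.evolve

theorem isProfile_upper (s : ℕ) : IsProfile (upper s) := by
  induction s with
  | zero => exact ⟨fun _ _ => zero_le_one, fun _ _ => le_rfl, fun _ _ => le_rfl⟩
  | succ s ih => rw [upper_succ]; exact ih.evolve

theorem upper_four_add_le : upper 4 1 + upper 4 2 ≤ 1 := by
  norm_num [upper, evolve]

/-- Away from the end, a geometric perturbation of rate `1 / 5` is multiplied by
`(5 + 1 + 1 / 5) / 3 = 31 / 15` at each step. -/
theorem lower_eq {s i : ℕ} (h : s < i) : lower s i = 1 - (31 / 15) ^ s / (4 * 5 ^ i) := by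
  induction s generalizing i with
  | zero => simp [lower]
  | succ s ih =>
    obtain ⟨i, rfl⟩ : ∃ i', i = i' + 2 := ⟨i - 2, by omega⟩
    rw [lower_succ, evolve, ih (by omega), ih (by omega), ih (by omega)]
    simp only [pow_succ]
    field_simp
    ring

theorem lower_four_one : (0.303 : ℝ) ≤ lower 4 1 := by norm_num [lower, evolve]

theorem lower_four_two : (0.6729 : ℝ) ≤ lower 4 2 := by norm_num [lower, evolve]

theorem lower_four_three : (0.8912 : ℝ) ≤ lower 4 3 := by norm_num [lower, evolve]

theorem lower_four_four : (0.9775 : ℝ) ≤ lower 4 4 := by norm_num [lower, evolve]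

theorem lower_four_five : (0.9985 : ℝ) ≤ lower 4 5 := by rw [lower_eq (by norm_num)]; norm_num

theorem lower_four_six : (0.9997 : ℝ) ≤ lower 4 6 := by rw [lower_eq (by norm_num)]; norm_num

/-- Shifting by the three agents shed, the lower profile is recovered after five steps. -/
theorem lower_zero_le_average {i : ℕ} (hi : 1 ≤ i) :
    lower 0 i ≤ (lower 4 (i + 2) + lower 4 (i + 3) + lower 4 (i + 4)) / 3 := by
  rcases (by omega : i = 1 ∨ i = 2 ∨ 3 ≤ i) with rfl | rfl | hi
  · have := lower_four_three
    have := lower_four_four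
    have := lower_four_five
    have : lower 0 1 = 0.95 := by norm_num [lower]
    linarith
  · have := lower_four_four
    have := lower_four_five
    have := lower_four_six
    have : lower 0 2 = 0.99 := by norm_num [lower]
    linarith
  · rw [lower_eq (by omega), lower_eq (by omega), lower_eq (by omega), lower_eq (by omega)]
    have h : (0 : ℝ) < 1 / 5 ^ i := by positivity
    have e : ∀ c : ℝ, ∀ r : ℕ, c / (4 * 5 ^ (i + r)) = c / (4 * 5 ^ r) * (1 / 5 ^ i) :=
      fun c r => by rw [pow_add]; field_simp
    rw [e, e, e, show (31 / 15 : ℝ) ^ 0 / (4 * 5 ^ i) = 1 / 4 * (1 / 5 ^ i) by field_simp]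
    generalize (1 : ℝ) / 5 ^ i = y at h ⊢
    norm_num
    linarith

theorem lower_add_lower_end {s : ℕ} (hs : s ≤ 3) : 1.08 ≤ lower s 1 + lower s 2 := by
  interval_cases s <;> norm_num [lower, evolve]

theorem lower_add_lower_inner {s : ℕ} (hs : s ≤ 4) : 1.56 ≤ lower s 2 + lower s 3 := by
  interval_cases s <;> norm_num [lower, evolve]

theorem lower_add_lower_far {s : ℕ} (hs : s ≤ 4) : 1.97 ≤ lower s 4 + lower s 5 := by
  interval_cases s <;> norm_num [lower, evolve]

theorem lower_add_lower_mono (s : ℕ) {i j : ℕ} (hi : 1 ≤ i) (hij : i ≤ j) :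
    lower s i + lower s (i + 1) ≤ lower s j + lower s (j + 1) :=
  add_le_add ((isProfile_lower s).mono hi hij) ((isProfile_lower s).mono (by omega) (by omega))

/-- With at least six agents, the two-sided lower bound keeps agents at distance two apart; from
the fourth step after a shedding on this fails for the two outermost pairs. -/
theorem three_lt_lower {s i j : ℕ} (hs : s ≤ 4) (hi : 1 ≤ i) (hj : 1 ≤ j) (hij : 5 ≤ i + j)
    (h : s ≤ 3 ∨ 2 ≤ i ∧ 2 ≤ j) :
    3 < (lower s i + lower s (i + 1)) + (lower s j + lower s (j + 1)) := by
  have h₂ := lower_add_lower_inner hs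
  have h₄ := lower_add_lower_far hs
  rcases (by omega : i = 1 ∨ j = 1 ∨ 2 ≤ i ∧ 2 ≤ j) with rfl | rfl | ⟨hi, hj⟩
  · have h₁ := lower_add_lower_end (s := s) (by omega)
    have := lower_add_lower_mono s (i := 4) (j := j) (by omega) (by omega)
    norm_num at *
    linarith
  · have h₁ := lower_add_lower_end (s := s) (by omega)
    have := lower_add_lower_mono s (i := 4) (j := i) (by omega) (by omega)
    norm_num at *
    linarith
  · have := lower_add_lower_mono s (i := 2) (j := i) (by omega) (by omega)
    have := lower_add_lower_mono s (i := 2) (j := j) (by omega) (by omega)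
    norm_num at *
    linarith

/-! ### Chains between two profiles -/

/-- The gaps of the block of `m` agents from `a` on lie between `L` superposed from both ends and
`V`. -/
def GapBounds {n : ℕ} (x : Fin n → ℝ) (a m : ℕ) (L V : ℕ → ℝ) : Prop :=
  ∀ i, 1 ≤ i → i < m → L i + L (m - i) - 1 ≤ gap x (a + i) ∧ gap x (a + i) ≤ V i

/-- The dynamics is linear and monotone in the gaps as long as the chain persists. The profiles
evolve as if the other end were not there, which only weakens the bounds: the end averages
`(g 1 + 2 * g 2) / 6` are smaller than inner ones, both for the gaps and for the defects `1 - L`. -/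
theorem Chain.gapBounds_step {n : ℕ} {x : Fin n → ℝ} {a m : ℕ} (h : Chain x a m) (hm : 3 ≤ m)
    {L V : ℕ → ℝ} (hL : IsProfile L) (hV : IsProfile V) (hx : GapBounds x a m L V) :
    GapBounds (step x) a m (evolve L) (evolve V) := by
  have hn := h.size
  obtain ⟨m, rfl⟩ : ∃ m', m = m' + 3 := ⟨m - 3, by omega⟩
  have h₁ := h.gap_step_left hm
  have b₁ := hx 1 le_rfl (by omega)
  have b₂ := hx 2 (by omega) (by omega)
  have ha := hL.le_one (m + 2) (by omega)
  have hb := hL.le_one (m + 3) (by omega)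
  have e₁ : m + 3 - 1 = m + 2 := rfl
  have e₂ : m + 3 - 2 = m + 1 := rfl
  rw [e₁] at b₁
  rw [e₂] at b₂
  have hleft : (evolve L 1 + evolve L (m + 2)) - 1 ≤ gap (step x) (a + 1) := by
    simp only [evolve]
    linarith
  intro i hi him
  rcases (by omega : i = 1 ∨ i = m + 2 ∨ 2 ≤ i ∧ i < m + 2) with rfl | rfl | ⟨hi, him⟩
  · refine ⟨hleft, ?_⟩
    simp only [evolve]
    linarith
  · have hs₀ := gap_symm h.reg.step (p := a + 1) (q := a + (m + 2)) (by omega) (by omega) (by omega)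
    have hs₁ := gap_symm h.reg (p := a + 1) (q := a + (m + 2)) (by omega) (by omega) (by omega)
    have hs₂ := gap_symm h.reg (p := a + 2) (q := a + (m + 1)) (by omega) (by omega) (by omega)
    refine ⟨?_, ?_⟩
    · rw [show m + 3 - (m + 2) = 1 by omega, ← hs₀]
      linarith
    · have c₁ := (hx (m + 2) (by omega) (by omega)).2
      have c₂ := (hx (m + 1) (by omega) (by omega)).2
      have := hV.nonneg (m + 2) (by omega)
      have := hV.nonneg (m + 3) (by omega)
      rw [← hs₀, h₁, hs₁, hs₂]
      simp only [evolve]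
      linarith
  · obtain ⟨i, rfl⟩ : ∃ i', i = i' + 2 := ⟨i - 2, by omega⟩
    obtain ⟨r, rfl⟩ : ∃ r, m = i + 1 + r := ⟨m - (i + 1), by omega⟩
    have c₁ := hx (i + 1) (by omega) (by omega)
    have c₂ := hx (i + 2) (by omega) (by omega)
    have c₃ := hx (i + 3) (by omega) (by omega)
    rw [h.gap_step_inner (by omega), show i + 1 + r + 3 - (i + 2) = r + 2 by omega]
    rw [show i + 1 + r + 3 - (i + 1) = r + 3 by omega] at c₁
    rw [show i + 1 + r + 3 - (i + 2) = r + 2 by omega] at c₂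
    rw [show i + 1 + r + 3 - (i + 3) = r + 1 by omega] at c₃
    simp only [evolve]
    constructor <;> linarith

theorem GapBounds.gap_le_one {n : ℕ} {x : Fin n → ℝ} {a m : ℕ} {L V : ℕ → ℝ} (hV : IsProfile V)
    (hx : GapBounds x a m L V) {i : ℕ} (hi : 1 ≤ i) (him : i < m) : gap x (a + i) ≤ 1 :=
  (hx i hi him).2.trans (hV.le_one i hi)

theorem GapBounds.one_lt_gap_add {n : ℕ} {x : Fin n → ℝ} {a m s : ℕ} {V : ℕ → ℝ} (hs : s ≤ 4)
    (hm : 6 ≤ m) (hx : GapBounds x a m (lower s) V) {i : ℕ} (hi : 1 ≤ i) (him : i + 1 < m)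
    (h : s ≤ 3 ∨ 2 ≤ i ∧ i + 2 < m) : 1 < gap x (a + i) + gap x (a + i + 1) := by
  obtain ⟨j, rfl⟩ : ∃ j, m = i + j + 1 := ⟨m - i - 1, by omega⟩
  have h₁ := (hx i hi (by omega)).1
  have h₂ := (hx (i + 1) (by omega) (by omega)).1
  have h₃ := three_lt_lower (i := i) (j := j) hs hi (by omega) (by omega) (by omega)
  rw [show i + j + 1 - i = j + 1 by omega] at h₁
  rw [show i + j + 1 - (i + 1) = j by omega, ← add_assoc] at h₂
  linarith

/-! ### Shedding of triples -/

/-- A chain that has contracted so far that the three agents at either end interact with each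
other, while all other interactions are still between consecutive agents. What concerns the right
end follows by symmetry. -/
structure Contracted {n : ℕ} (x : Fin n → ℝ) (a m : ℕ) : Prop where
  reg : Regular x
  size : a + m + a = n
  cut : Cut x a
  gap_le : ∀ i, 1 ≤ i → i < m → gap x (a + i) ≤ 1
  gap_add_le : gap x (a + 1) + gap x (a + 2) ≤ 1
  lt_gap_add : ∀ i, 2 ≤ i → i + 2 < m → 1 < gap x (a + i) + gap x (a + i + 1)

theorem Contracted.val_step_left {n : ℕ} {x : Fin n → ℝ} {a m : ℕ} (h : Contracted x a m)
    (hm : 5 ≤ m) {r : ℕ} (hr : r ≤ 1) :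
    val (step x) (a + r) = (val x a + val x (a + 1) + val x (a + 2)) / 3 := by
  have hn := h.size
  have h₁ := h.gap_add_le
  have h₂ := h.lt_gap_add 2 le_rfl (by omega)
  have m₁ := val_mono h.reg.mono (i := a) (j := a + r) (by omega) (by omega)
  have m₂ := val_mono h.reg.mono (i := a + r) (j := a + 1) (by omega) (by omega)
  have m₃ := val_mono h.reg.mono (i := a + 1) (j := a + 2) (by omega) (by omega)
  have e : a + 2 - 1 = a + 1 := rfl
  have e' : a + 3 - 1 = a + 2 := rfl
  simp only [gap, Nat.add_sub_cancel, e, add_assoc, Nat.reduceAdd] at h₁ h₂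
  rw [e'] at h₂
  rw [val_step h.reg.mono a 3 (by omega) (by omega) (by omega) (by linarith)
    (by rw [e']; linarith) (.inl h.cut) (.inr (by linarith))]
  simp [Finset.sum_range_succ]

theorem Contracted.val_step_two {n : ℕ} {x : Fin n → ℝ} {a m : ℕ} (h : Contracted x a m)
    (hm : 6 ≤ m) : val (step x) (a + 2) =
      (val x a + val x (a + 1) + val x (a + 2) + val x (a + 3)) / 4 := by
  have hn := h.size
  have h₁ := h.gap_add_le
  have h₂ := h.lt_gap_add 3 (by omega) (by omega)
  have h₃ := h.gap_le 3 (by omega) (by omega)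
  have e : a + 2 - 1 = a + 1 := rfl
  have e' : a + 3 - 1 = a + 2 := rfl
  have e'' : a + 4 - 1 = a + 3 := rfl
  simp only [gap, Nat.add_sub_cancel, e, e', e'', add_assoc, Nat.reduceAdd] at h₁ h₂ h₃
  rw [val_step h.reg.mono a 4 (by omega) (by omega) (by omega)
      (by linarith) (by rw [e'']; linarith) (.inl h.cut) (.inr (by linarith))]
  simp [Finset.sum_range_succ]

theorem Contracted.val_step_inner {n : ℕ} {x : Fin n → ℝ} {a m : ℕ} (h : Contracted x a m)
    {i : ℕ} (hi : 2 ≤ i) (him : i + 4 < m) :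
    val (step x) (a + i + 1) = (val x (a + i) + val x (a + i + 1) + val x (a + i + 2)) / 3 := by
  have hn := h.size
  obtain ⟨i, rfl⟩ : ∃ i', i = i' + 1 := ⟨i - 1, by omega⟩
  have h₁ := h.gap_le (i + 2) (by omega) (by omega)
  have h₂ := h.gap_le (i + 3) (by omega) (by omega)
  have h₃ := h.lt_gap_add (i + 1) (by omega) (by omega)
  have h₄ := h.lt_gap_add (i + 3) (by omega) (by omega)
  have e₀ : a + (i + 1) - 1 = a + i := rfl
  have e₁ : a + (i + 2) - 1 = a + (i + 1) := rfl
  have e₂ : a + (i + 3) - 1 = a + (i + 2) := rfl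
  have e₃ : a + (i + 4) - 1 = a + (i + 3) := rfl
  simp only [gap, e₀, e₁, e₂, e₃, add_assoc, Nat.reduceAdd] at h₁ h₂ h₃ h₄ ⊢
  rw [val_step h.reg.mono (a + (i + 1)) 3 (by omega) (by omega) (by omega) h₁
    (by rw [show a + (i + 1) + 3 - 1 = a + (i + 3) by omega]; exact h₂) (.inr ?_) (.inr ?_)]
  · simp [Finset.sum_range_succ, add_assoc]
  · rw [e₀]
    linarith
  · rw [show a + (i + 1) + 3 = a + (i + 4) by omega]
    linarith

theorem Contracted.gap_step_inner {n : ℕ} {x : Fin n → ℝ} {a m : ℕ} (h : Contracted x a m)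
    {i : ℕ} (hi : 2 ≤ i) (him : i + 5 < m) : gap (step x) (a + (i + 2)) =
      (gap x (a + (i + 1)) + gap x (a + (i + 2)) + gap x (a + (i + 3))) / 3 := by
  have h₁ := h.val_step_inner (i := i) hi (by omega)
  have h₂ := h.val_step_inner (i := i + 1) (by omega) (by omega)
  have e₀ : a + (i + 1) - 1 = a + i := rfl
  have e₁ : a + (i + 2) - 1 = a + (i + 1) := rfl
  have e₂ : a + (i + 3) - 1 = a + (i + 2) := rfl
  simp only [gap, e₀, e₁, e₂, add_assoc, Nat.reduceAdd] at h₁ h₂ ⊢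
  rw [h₁, h₂]
  ring

theorem Contracted.gap_step_one {n : ℕ} {x : Fin n → ℝ} {a m : ℕ} (h : Contracted x a m)
    (hm : 5 ≤ m) : gap (step x) (a + 1) = 0 := by
  have h₀ := h.val_step_left hm (r := 0) (by omega)
  have h₁ := h.val_step_left hm (r := 1) (by omega)
  rw [gap, h₁, Nat.add_sub_cancel, ← h₀]
  simp

/-- In the shedding step the third agent still feels the fourth one, so that the triple is not yet
a cluster. -/
theorem Contracted.gap_step_two {n : ℕ} {x : Fin n → ℝ} {a m : ℕ} (h : Contracted x a m)
    (hm : 6 ≤ m) : gap (step x) (a + 2) =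
      (gap x (a + 1) + 2 * gap x (a + 2) + 3 * gap x (a + 3)) / 12 := by
  have h₁ := h.val_step_left (by omega) (r := 1) (by omega)
  have h₂ := h.val_step_two hm
  have e : a + 2 - 1 = a + 1 := rfl
  have e' : a + 3 - 1 = a + 2 := rfl
  simp only [gap, Nat.add_sub_cancel, e, e'] at h₁ h₂ ⊢
  rw [h₁, h₂]
  ring

theorem Contracted.gap_step_three {n : ℕ} {x : Fin n → ℝ} {a m : ℕ} (h : Contracted x a m)
    (hm : 7 ≤ m) : gap (step x) (a + 3) = gap x (a + 1) / 4 + gap x (a + 2) / 2 +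
      5 / 12 * gap x (a + 3) + gap x (a + 4) / 3 := by
  have h₁ := h.val_step_two (by omega)
  have h₂ := h.val_step_inner (i := 2) le_rfl (by omega)
  have e : a + 2 - 1 = a + 1 := rfl
  have e' : a + 3 - 1 = a + 2 := rfl
  have e'' : a + 4 - 1 = a + 3 := rfl
  simp only [gap, Nat.add_sub_cancel, e, e', e'', add_assoc, Nat.reduceAdd] at h₁ h₂ ⊢
  rw [h₁, h₂]
  ring

/-- If only six agents are left, then both middle agents have four neighbours. -/
theorem Contracted.gap_step_three_of_six {n : ℕ} {x : Fin n → ℝ} {a : ℕ} (h : Contracted x a 6) :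
    gap (step x) (a + 3) =
      (gap x (a + 1) + 2 * gap x (a + 2) + 2 * gap x (a + 3) + 2 * gap x (a + 4) +
        gap x (a + 5)) / 4 := by
  have hn := h.size
  have h₁ := h.val_step_two le_rfl
  have h₂ := val_symm h.reg.step (i := a + 2) (j := a + 3) (by omega)
  have s₀ := val_symm h.reg (i := a) (j := a + 5) (by omega)
  have s₁ := val_symm h.reg (i := a + 1) (j := a + 4) (by omega)
  have s₂ := val_symm h.reg (i := a + 2) (j := a + 3) (by omega)
  have e : a + 2 - 1 = a + 1 := rfl
  have e' : a + 3 - 1 = a + 2 := rfl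
  have e'' : a + 4 - 1 = a + 3 := rfl
  have e₃ : a + 5 - 1 = a + 4 := rfl
  simp only [gap, Nat.add_sub_cancel, e, e', e'', e₃] at h₁ h₂ ⊢
  linarith

/-! ### The first `5 * k` time steps -/

/-- The invariant `s` steps after `j` triples have been shed at either end: the `n - 6 * j` remaining
agents are cut off from the shed ones, and their gaps lie between the profiles. -/
structure Phase (n j s : ℕ) : Prop where
  size : 6 * j ≤ n
  cut : Cut (opinion n (5 * j + s)) (3 * j)
  bounds : GapBounds (opinion n (5 * j + s)) (3 * j) (n - 6 * j) (lower s) (upper s)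

theorem Phase.chain {n j s : ℕ} (h : Phase n j s) (hs : s ≤ 3) (hj : 6 * (j + 1) ≤ n) :
    Chain (opinion n (5 * j + s)) (3 * j) (n - 6 * j) where
  reg := regular_opinion _ _
  size := by omega
  cut := h.cut
  gap_le _ hi him := h.bounds.gap_le_one (isProfile_upper s) hi him
  lt_gap_add _ hi him := h.bounds.one_lt_gap_add (by omega) (by omega) hi him (.inl hs)

theorem Phase.contracted {n j : ℕ} (h : Phase n j 4) (hj : 6 * (j + 1) ≤ n) :
    Contracted (opinion n (5 * j + 4)) (3 * j) (n - 6 * j) where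
  reg := regular_opinion _ _
  size := by omega
  cut := h.cut
  gap_le _ hi him := h.bounds.gap_le_one (isProfile_upper 4) hi him
  gap_add_le := (add_le_add (h.bounds 1 (by omega) (by omega)).2
    (h.bounds 2 (by omega) (by omega)).2).trans upper_four_add_le
  lt_gap_add _ hi him := h.bounds.one_lt_gap_add le_rfl (by omega) (by omega) (by omega)
    (.inr ⟨hi, him⟩)

theorem Phase.step {n j s : ℕ} (h : Phase n j s) (hs : s ≤ 3) (hj : 6 * (j + 1) ≤ n) :
    Phase n j (s + 1) where
  size := h.size
  cut := h.cut.opinion (by omega) (by omega)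
  bounds := by
    rw [← add_assoc, opinion_succ, lower_succ, upper_succ]
    exact (h.chain hs hj).gapBounds_step (by omega) (isProfile_lower s) (isProfile_upper s) h.bounds

/-- The triple at the left end is cut off. -/
theorem Phase.one_lt_gap {n j : ℕ} (h : Phase n j 4) (hj : 6 * (j + 1) ≤ n) :
    1 < gap (opinion n (5 * j + 5)) (3 * j + 3) := by
  have hc := h.contracted hj
  have hb := h.bounds
  rw [show 5 * j + 5 = 5 * j + 4 + 1 by omega, opinion_succ]
  obtain ⟨m, hm⟩ : ∃ m, n - 6 * j = m + 6 := ⟨n - 6 * j - 6, by omega⟩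
  rw [hm] at hc hb
  have hp := isProfile_lower 4
  have b₁ := (hb 1 (by omega) (by omega)).1
  have b₂ := (hb 2 (by omega) (by omega)).1
  have b₃ := (hb 3 (by omega) (by omega)).1
  have b₄ := (hb 4 (by omega) (by omega)).1
  have l₁ := lower_four_one
  have l₂ := lower_four_two
  have l₃ := lower_four_three
  have l₄ := lower_four_four
  have l₅ := lower_four_five
  have l₆ := lower_four_six
  by_cases hm0 : m = 0
  · subst hm0
    have b₅ := (hb 5 (by omega) (by omega)).1
    rw [hc.gap_step_three_of_six]
    norm_num at b₁ b₂ b₃ b₄ b₅ ⊢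
    linarith
  · rw [hc.gap_step_three (by omega)]
    have r₁ := hp.mono (i := 6) (j := m + 6 - 1) (by omega) (by omega)
    have r₂ := hp.mono (i := 5) (j := m + 6 - 2) (by omega) (by omega)
    have r₃ := hp.mono (i := 4) (j := m + 6 - 3) (by omega) (by omega)
    have r₄ := hp.mono (i := 3) (j := m + 6 - 4) (by omega) (by omega)
    linarith

/-- The agents that remain after a shedding are again close to equally spaced. -/
theorem Phase.next {n j : ℕ} (h : Phase n j 4) (hj : 6 * (j + 1) ≤ n) : Phase n (j + 1) 0 where
  size := hj
  cut := .inr (.inr (h.one_lt_gap hj))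
  bounds := by
    have hc := h.contracted hj
    have hb := h.bounds
    intro i hi him
    obtain ⟨r, hr⟩ : ∃ r, n - 6 * j = i + r + 6 := ⟨n - 6 * j - i - 6, by omega⟩
    rw [hr] at hc hb
    have b₂ := hb (i + 2) (by omega) (by omega)
    have b₃ := hb (i + 3) (by omega) (by omega)
    have b₄ := hb (i + 4) (by omega) (by omega)
    rw [show i + r + 6 - (i + 2) = r + 4 by omega] at b₂
    rw [show i + r + 6 - (i + 3) = r + 3 by omega] at b₃
    rw [show i + r + 6 - (i + 4) = r + 2 by omega] at b₄
    have l₁ := lower_zero_le_average hi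
    have l₂ := lower_zero_le_average (i := r) (by omega)
    have v := isProfile_upper 4
    have v₂ := v.le_one (i + 2) (by omega)
    have v₃ := v.le_one (i + 3) (by omega)
    have v₄ := v.le_one (i + 4) (by omega)
    rw [show 5 * (j + 1) + 0 = 5 * j + 4 + 1 by omega, opinion_succ,
      show 3 * (j + 1) + i = 3 * j + (i + 1 + 2) by omega,
      hc.gap_step_inner (by omega) (by omega), show n - 6 * (j + 1) - i = r by omega]
    have hu : upper 0 i = 1 := rfl
    rw [hu]
    constructor <;> linarith

theorem phase_zero (n : ℕ) : Phase n 0 0 where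
  size := by omega
  cut := .inl rfl
  bounds := by
    intro i hi him
    have h₁ := (isProfile_lower 0).le_one i hi
    have h₂ := (isProfile_lower 0).le_one (n - 6 * 0 - i) (by omega)
    have hu : upper 0 i = 1 := rfl
    have hg : gap (opinion n (5 * 0 + 0)) (3 * 0 + i) = 1 := by
      obtain ⟨i, rfl⟩ : ∃ i', i = i' + 1 := ⟨i - 1, by omega⟩
      simp only [mul_zero, add_zero, zero_add]
      rw [gap, val_of_lt _ (by omega : i + 1 < n), val_of_lt _ (by omega : i + 1 - 1 < n)]
      simp [opinion, equallySpaced]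
    rw [hu, hg]
    constructor <;> linarith

/-- The invariant holds throughout; after the last shedding only at `s = 0`, since fewer than six
agents need not form a chain for four steps. -/
theorem phase {n j s : ℕ} (hs : s ≤ 4) (hj : 6 * j ≤ n) (h : s = 0 ∨ 6 * (j + 1) ≤ n) :
    Phase n j s := by
  have hstep : ∀ {j}, Phase n j 0 → 6 * (j + 1) ≤ n → ∀ s, s ≤ 4 → Phase n j s := by
    intro j h₀ hj s hs
    induction s with
    | zero => exact h₀
    | succ s ih => exact (ih (by omega)).step (by omega) hj
  have hzero : ∀ j, 6 * j ≤ n → Phase n j 0 := by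
    intro j hj
    induction j with
    | zero => exact phase_zero n
    | succ j ih => exact (hstep (ih (by omega)) hj 4 le_rfl).next hj
  rcases h with rfl | h
  · exact hzero j hj
  · exact hstep (hzero j hj) h s hs

/-! ### The collapse of the last two to five agents -/

/-- The block of `m` agents from `a` on stays connected for the first `T` steps, without being a
cluster after `T` steps, and is a cluster after `T + 1` steps. -/
structure Collapses {n : ℕ} (x : Fin n → ℝ) (a m T : ℕ) : Prop where
  gap_le : ∀ s ≤ T, ∀ i, 1 ≤ i → i < m → gap (step^[s] x) (a + i) ≤ 1
  gap_pos : ∃ i, 1 ≤ i ∧ i < m ∧ 0 < gap (step^[T] x) (a + i)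
  agree : AgreeOn (step^[T + 1] x) (block n a (a + m))

theorem Collapses.succ {n : ℕ} {x : Fin n → ℝ} {a m T : ℕ} (h : Collapses (step x) a m T)
    (hx : ∀ i, 1 ≤ i → i < m → gap x (a + i) ≤ 1) : Collapses x a m (T + 1) where
  gap_le := by
    rintro (_ | s) hs
    · exact hx
    · exact h.gap_le s (by omega)
  gap_pos := h.gap_pos
  agree := h.agree

theorem collapses_zero {n : ℕ} {x : Fin n → ℝ} (hx : Regular x) {a m : ℕ} (hn : a + m + a = n)
    (ha : Cut x a) (h : ∀ i, 1 ≤ i → i < m → gap x (a + i) ≤ 1)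
    (h' : ∃ i, 1 ≤ i ∧ i < m ∧ 0 < gap x (a + i)) (h'' : val x (a + m - 1) - val x a ≤ 1) :
    Collapses x a m 0 where
  gap_le := by
    intro s hs
    obtain rfl : s = 0 := by omega
    exact h
  gap_pos := h'
  agree := collapse hx.mono (by omega) ha (ha.symm hx (by omega)) h''

theorem gap_symm_block {n : ℕ} {x : Fin n → ℝ} (hx : Regular x) {a m : ℕ} (hn : a + m + a = n)
    {i j : ℕ} (hi : 1 ≤ i) (hj : 1 ≤ j) (hij : i + j = m) : gap x (a + i) = gap x (a + j) :=
  gap_symm hx (by omega) (by omega) (by omega)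

theorem gap_le_one_of_half {n : ℕ} {x : Fin n → ℝ} (hx : Regular x) {a m : ℕ}
    (hn : a + m + a = n) (h : ∀ i, 1 ≤ i → 2 * i ≤ m → gap x (a + i) ≤ 1) (i : ℕ) (hi : 1 ≤ i)
    (him : i < m) : gap x (a + i) ≤ 1 := by
  by_cases hi' : 2 * i ≤ m
  · exact h i hi hi'
  · rw [gap_symm_block hx hn hi (by omega : 1 ≤ m - i) (by omega)]
    exact h _ (by omega) (by omega)

theorem gap_le_one_of_le_five {n : ℕ} {x : Fin n → ℝ} (hx : Regular x) {a m : ℕ}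
    (hn : a + m + a = n) (hm : m ≤ 5) (h₁ : gap x (a + 1) ≤ 1) (h₂ : gap x (a + 2) ≤ 1) :
    ∀ i, 1 ≤ i → i < m → gap x (a + i) ≤ 1 := by
  refine gap_le_one_of_half hx hn fun i hi hi' => ?_
  rcases (by omega : i = 1 ∨ i = 2) with rfl | rfl
  · exact h₁
  · exact h₂

theorem collapses_two {n : ℕ} {x : Fin n → ℝ} (hx : Regular x) {a : ℕ} (hn : a + 2 + a = n)
    (ha : Cut x a) (h₀ : 0 < gap x (a + 1)) (h₁ : gap x (a + 1) ≤ 1) : Collapses x a 2 0 :=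
  collapses_zero hx hn ha
    (fun i hi hi' => by rw [show i = 1 by omega]; exact h₁)
    ⟨1, le_rfl, by omega, h₀⟩ h₁

theorem collapses_three {n : ℕ} {x : Fin n → ℝ} (hx : Regular x) {a : ℕ} (hn : a + 3 + a = n)
    (ha : Cut x a) (h₀ : 1 / 2 < gap x (a + 1)) (h₁ : gap x (a + 1) ≤ 1) : Collapses x a 3 1 := by
  have hs := gap_symm_block hx hn (i := 1) (j := 2) le_rfl (by omega) rfl
  have hle := gap_le_one_of_le_five hx hn (by omega) h₁ (hs ▸ h₁)
  have hc : Chain x a 3 := ⟨hx, hn, ha, hle, fun i hi hi' => by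
    obtain rfl : i = 1 := by omega
    rw [show a + 1 + 1 = a + 2 by omega, ← hs]
    linarith⟩
  have g₁ := hc.gap_step_left le_rfl
  have hs' := gap_symm_block hx.step hn (i := 1) (j := 2) le_rfl (by omega) rfl
  refine Collapses.succ (collapses_zero hx.step hn (ha.step hx.mono (by omega))
    (gap_le_one_of_le_five hx.step hn (by omega) (by linarith) (by linarith))
    ⟨1, le_rfl, by omega, by linarith⟩ ?_) hle
  have e : a + 3 - 1 = a + 2 := rfl
  rw [e]
  have k₁ : gap (step x) (a + 1) = val (step x) (a + 1) - val (step x) a := rfl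
  have k₂ : gap (step x) (a + 2) = val (step x) (a + 2) - val (step x) (a + 1) := rfl
  linarith

theorem chain_four {n : ℕ} {x : Fin n → ℝ} (hx : Regular x) {a : ℕ} (hn : a + 4 + a = n)
    (ha : Cut x a) (h₁ : gap x (a + 1) ≤ 1) (h₂ : gap x (a + 2) ≤ 1)
    (h : 1 < gap x (a + 1) + gap x (a + 2)) : Chain x a 4 where
  reg := hx
  size := hn
  cut := ha
  gap_le := gap_le_one_of_le_five hx hn (by omega) h₁ h₂
  lt_gap_add i hi hi' := by
    have hs := gap_symm_block hx hn (i := 1) (j := 3) le_rfl (by omega) rfl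
    rcases (by omega : i = 1 ∨ i = 2) with rfl | rfl
    · exact h
    · rw [show a + 2 + 1 = a + 3 by omega, ← hs]
      linarith

theorem Chain.gap_step_of_four {n : ℕ} {x : Fin n → ℝ} {a : ℕ} (h : Chain x a 4) :
    gap (step x) (a + 1) = (gap x (a + 1) + 2 * gap x (a + 2)) / 6 ∧
      gap (step x) (a + 2) = (2 * gap x (a + 1) + gap x (a + 2)) / 3 := by
  refine ⟨h.gap_step_left (by omega), ?_⟩
  have := h.gap_step_inner (i := 0) (by omega)
  have hs := gap_symm_block h.reg h.size (i := 1) (j := 3) le_rfl (by omega) rfl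
  simp only [zero_add] at this
  rw [this, ← hs]
  ring

/-- Four agents of which only the two outermost do not interact. -/
theorem collapses_four_of_contracted {n : ℕ} {x : Fin n → ℝ} (hx : Regular x) {a : ℕ}
    (hn : a + 4 + a = n) (ha : Cut x a) (h₀ : 0 < gap x (a + 2))
    (h : gap x (a + 1) + gap x (a + 2) ≤ 1)
    (h' : 1 < 2 * gap x (a + 1) + gap x (a + 2)) : Collapses x a 4 1 := by
  have p₁ := gap_nonneg hx.mono (p := a + 1) (by omega)
  have hs := gap_symm_block hx hn (i := 1) (j := 3) le_rfl (by omega) rfl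
  have k₁ : gap x (a + 1) = val x (a + 1) - val x a := rfl
  have k₂ : gap x (a + 2) = val x (a + 2) - val x (a + 1) := rfl
  have k₃ : gap x (a + 3) = val x (a + 3) - val x (a + 2) := rfl
  have e₂ : a + 3 - 1 = a + 2 := rfl
  have e₃ : a + 4 - 1 = a + 3 := rfl
  have v₀ : val (step x) a = (val x a + val x (a + 1) + val x (a + 2)) / 3 := by
    rw [val_step hx.mono a 3 le_rfl (by omega) (by omega) (by linarith) (by rw [e₂]; linarith)
      (.inl ha) (.inr (by linarith))]
    simp [Finset.sum_range_succ]
  have v₁ : val (step x) (a + 1) =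
      (val x a + val x (a + 1) + val x (a + 2) + val x (a + 3)) / 4 := by
    rw [val_step hx.mono a 4 (by omega) (by omega) (by omega) (by linarith)
      (by rw [e₃]; linarith) (.inl ha) (.inl (ha.symm hx (by omega)))]
    simp [Finset.sum_range_succ]
  have s₀ := val_symm hx (i := a) (j := a + 3) (by omega)
  have s₁ := val_symm hx (i := a + 1) (j := a + 2) (by omega)
  have s₀' := val_symm hx.step (i := a) (j := a + 3) (by omega)
  have s₁' := val_symm hx.step (i := a + 1) (j := a + 2) (by omega)
  have k₁' : gap (step x) (a + 1) = val (step x) (a + 1) - val (step x) a := rfl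
  have k₂' : gap (step x) (a + 2) = val (step x) (a + 2) - val (step x) (a + 1) := rfl
  exact Collapses.succ (collapses_zero hx.step hn (ha.step hx.mono (by omega))
    (gap_le_one_of_le_five hx.step hn (by omega) (by linarith) (by linarith))
    ⟨1, le_rfl, by omega, by linarith⟩ (by rw [e₃]; linarith))
    (gap_le_one_of_le_five hx hn (by omega) (by linarith) (by linarith))

theorem collapses_four {n : ℕ} {x : Fin n → ℝ} (hx : Regular x) {a : ℕ} (hn : a + 4 + a = n)
    (ha : Cut x a) (h₁ : 0.94 ≤ gap x (a + 1)) (h₁' : gap x (a + 1) ≤ 1)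
    (h₂ : 0.94 ≤ gap x (a + 2)) (h₂' : gap x (a + 2) ≤ 1) : Collapses x a 4 4 := by
  norm_num at h₁ h₂
  have c₀ := chain_four hx hn ha (by linarith) (by linarith) (by linarith)
  have a₁ := ha.step hx.mono (by omega)
  obtain ⟨u₁, w₁⟩ := c₀.gap_step_of_four
  have c₁ := chain_four hx.step hn a₁ (by linarith) (by linarith) (by linarith)
  have a₂ := a₁.step hx.step.mono (by omega)
  obtain ⟨u₂, w₂⟩ := c₁.gap_step_of_four
  have c₂ := chain_four hx.step.step hn a₂ (by linarith) (by linarith) (by linarith)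
  have a₃ := a₂.step hx.step.step.mono (by omega)
  obtain ⟨u₃, w₃⟩ := c₂.gap_step_of_four
  exact (((collapses_four_of_contracted hx.step.step.step hn a₃ (by linarith) (by linarith)
    (by linarith)).succ c₂.gap_le).succ c₁.gap_le).succ c₀.gap_le

theorem chain_five {n : ℕ} {x : Fin n → ℝ} (hx : Regular x) {a : ℕ} (hn : a + 5 + a = n)
    (ha : Cut x a) (h₁ : gap x (a + 1) ≤ 1) (h₂ : gap x (a + 2) ≤ 1)
    (h : 1 < gap x (a + 1) + gap x (a + 2)) (h' : 1 < 2 * gap x (a + 2)) : Chain x a 5 where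
  reg := hx
  size := hn
  cut := ha
  gap_le := gap_le_one_of_le_five hx hn (by omega) h₁ h₂
  lt_gap_add i hi hi' := by
    have hs := gap_symm_block hx hn (i := 1) (j := 4) le_rfl (by omega) rfl
    have hs' := gap_symm_block hx hn (i := 2) (j := 3) (by omega) (by omega) rfl
    rcases (by omega : i = 1 ∨ i = 2 ∨ i = 3) with rfl | rfl | rfl
    · exact h
    · rw [show a + 2 + 1 = a + 3 by omega, ← hs']
      linarith
    · rw [show a + 3 + 1 = a + 4 by omega, ← hs, ← hs']
      linarith

theorem Chain.gap_step_of_five {n : ℕ} {x : Fin n → ℝ} {a : ℕ} (h : Chain x a 5) :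
    gap (step x) (a + 1) = (gap x (a + 1) + 2 * gap x (a + 2)) / 6 ∧
      gap (step x) (a + 2) = (gap x (a + 1) + 2 * gap x (a + 2)) / 3 := by
  refine ⟨h.gap_step_left (by omega), ?_⟩
  have := h.gap_step_inner (i := 0) (by omega)
  have hs := gap_symm_block h.reg h.size (i := 2) (j := 3) (by omega) (by omega) rfl
  simp only [zero_add] at this
  rw [this, ← hs]
  ring

/-- Five agents whose outer pairs are within the confidence bound of the central agent. -/
theorem collapses_five_of_contracted {n : ℕ} {x : Fin n → ℝ} (hx : Regular x) {a : ℕ}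
    (hn : a + 5 + a = n) (ha : Cut x a) (h : gap x (a + 1) + gap x (a + 2) ≤ 1)
    (h' : 1 < 2 * gap x (a + 2)) (h'' : 2 * (gap x (a + 1) + 2 * gap x (a + 2)) ≤ 3) :
    Collapses x a 5 1 := by
  have p₁ := gap_nonneg hx.mono (p := a + 1) (by omega)
  have hle := gap_le_one_of_le_five hx hn (by omega) (by linarith) (by linarith)
  have hc : Contracted x a 5 := ⟨hx, hn, ha, hle, h, fun i hi hi' => by
    obtain rfl : i = 2 := by omega
    have hs' := gap_symm_block hx hn (i := 2) (j := 3) (by omega) (by omega) rfl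
    rw [show a + 2 + 1 = a + 3 by omega, ← hs']
    linarith⟩
  have k₁ : gap x (a + 1) = val x (a + 1) - val x a := rfl
  have k₂ : gap x (a + 2) = val x (a + 2) - val x (a + 1) := rfl
  have v₀ := hc.val_step_left le_rfl (r := 0) (by omega)
  have v₁ := hc.val_step_left le_rfl (r := 1) le_rfl
  rw [add_zero] at v₀
  -- by symmetry the central agent does not move
  have s₂ := val_symm hx (i := a + 2) (j := a + 2) (by omega)
  have s₂' := val_symm hx.step (i := a + 2) (j := a + 2) (by omega)
  have s₀' := val_symm hx.step (i := a) (j := a + 4) (by omega)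
  have k₁' : gap (step x) (a + 1) = val (step x) (a + 1) - val (step x) a := rfl
  have k₂' : gap (step x) (a + 2) = val (step x) (a + 2) - val (step x) (a + 1) := rfl
  have e : a + 5 - 1 = a + 4 := rfl
  exact Collapses.succ (collapses_zero hx.step hn (ha.step hx.mono (by omega))
    (gap_le_one_of_le_five hx.step hn (by omega) (by linarith) (by linarith))
    ⟨2, by omega, by omega, by linarith⟩ (by rw [e]; linarith)) hle

theorem collapses_five {n : ℕ} {x : Fin n → ℝ} (hx : Regular x) {a : ℕ} (hn : a + 5 + a = n)
    (ha : Cut x a) (h₁ : 0.94 ≤ gap x (a + 1)) (h₁' : gap x (a + 1) ≤ 1)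
    (h₂ : 0.98 ≤ gap x (a + 2)) (h₂' : gap x (a + 2) ≤ 1) : Collapses x a 5 5 := by
  norm_num at h₁ h₂
  have c₀ := chain_five hx hn ha (by linarith) (by linarith) (by linarith) (by linarith)
  have a₁ := ha.step hx.mono (by omega)
  obtain ⟨u₁, w₁⟩ := c₀.gap_step_of_five
  have c₁ := chain_five hx.step hn a₁ (by linarith) (by linarith) (by linarith) (by linarith)
  have a₂ := a₁.step hx.step.mono (by omega)
  obtain ⟨u₂, w₂⟩ := c₁.gap_step_of_five
  have c₂ := chain_five hx.step.step hn a₂ (by linarith) (by linarith) (by linarith) (by linarith)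
  have a₃ := a₂.step hx.step.step.mono (by omega)
  obtain ⟨u₃, w₃⟩ := c₂.gap_step_of_five
  have c₃ := chain_five hx.step.step.step hn a₃ (by linarith) (by linarith) (by linarith)
    (by linarith)
  have a₄ := a₃.step hx.step.step.step.mono (by omega)
  obtain ⟨u₄, w₄⟩ := c₃.gap_step_of_five
  exact ((((collapses_five_of_contracted hx.step.step.step.step hn a₄ (by linarith) (by linarith)
    (by linarith)).succ c₃.gap_le).succ c₂.gap_le).succ c₁.gap_le).succ c₀.gap_le

/-- The gaps left over by the sheddings are so close to `1` that the `l` central agents evolve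
qualitatively as if they started equally spaced. -/
theorem Phase.collapses {n k l : ℕ} (h : Phase n k 0) (hn : n = 6 * k + l) (hl : 2 ≤ l)
    (hl' : l ≤ 5) : Collapses (opinion n (5 * k)) (3 * k) l (eps l - 1) := by
  have hx := regular_opinion n (5 * k)
  have hc := h.cut
  have hb := h.bounds
  rw [show n - 6 * k = l by omega, add_zero] at hb
  have l₁ : lower 0 1 = 0.95 := by norm_num [lower]
  have l₂ : lower 0 2 = 0.99 := by norm_num [lower]
  have hp := isProfile_lower 0
  have hu : ∀ i, upper 0 i = 1 := fun _ => rfl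
  obtain ⟨b₁, b₁'⟩ := hb 1 le_rfl (by omega)
  rw [hu] at b₁'
  have hmono : lower 0 1 ≤ lower 0 (l - 1) := hp.mono le_rfl (by omega)
  rcases (by omega : l = 2 ∨ l = 3 ∨ 4 ≤ l) with rfl | rfl | hl
  · exact collapses_two hx (by omega) hc (by linarith) b₁'
  · exact collapses_three hx (by omega) hc (by linarith) b₁'
  obtain ⟨b₂, b₂'⟩ := hb 2 (by omega) (by omega)
  rw [hu] at b₂'
  have m₁ : lower 0 2 ≤ lower 0 (l - 1) := hp.mono (by omega) (by omega)
  have m₂ : lower 0 2 ≤ lower 0 (l - 2) := hp.mono (by omega) (by omega)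
  rcases (by omega : l = 4 ∨ l = 5) with rfl | rfl
  · exact collapses_four hx (by omega) hc (by linarith) b₁' (by linarith) b₂'
  · exact collapses_five hx (by omega) hc (by linarith) b₁' (by linarith) b₂'

/-! ### The triples and the middle block -/

theorem cut_left {n j t : ℕ} (hj : 6 * j ≤ n) (ht : 5 * j ≤ t) : Cut (opinion n t) (3 * j) :=
  (phase (s := 0) (by omega) hj (.inl rfl)).cut.opinion ht (by omega)

theorem cut_right {n j t : ℕ} (hj : 6 * j ≤ n) (ht : 5 * j ≤ t) : Cut (opinion n t) (n - 3 * j) :=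
  (cut_left hj ht).symm (regular_opinion n t) (by omega)

theorem AgreeOn.symm {n : ℕ} {x : Fin n → ℝ} (hx : Regular x) {p q : ℕ}
    (h : AgreeOn x (block n p q)) : AgreeOn x (block n (n - q) (n - p)) := by
  intro i hi j hj
  rw [mem_block] at hi hj
  have := h i.rev (by rw [mem_block, Fin.val_rev]; omega) j.rev
    (by rw [mem_block, Fin.val_rev]; omega)
  have := hx.symm i
  have := hx.symm j
  linarith

theorem isComponent_symm {n : ℕ} {x : Fin n → ℝ} (hx : Regular x) {p q : ℕ} (hpq : p < q)
    (hqn : q ≤ n) (hp : Cut x p) (hq : Cut x q) (hgap : ∀ r, p < r → r < q → gap x r ≤ 1) :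
    IsComponent x (block n (n - q) (n - p)) :=
  isComponent_block hx.mono (by omega) (by omega) (hq.symm hx (by omega)) (hp.symm hx (by omega))
    fun r hr hr' => by
      rw [gap_symm hx (q := n - r) (by omega) (by omega) (by omega)]
      exact hgap _ (by omega) (by omega)

section Triples

variable {n j t : ℕ}

theorem gap_triple_one (hj : 6 * (j + 1) ≤ n) :
    gap (opinion n (5 * (j + 1))) (3 * j + 1) = 0 := by
  rw [show 5 * (j + 1) = 5 * j + 4 + 1 by omega, opinion_succ]
  exact ((phase le_rfl (by omega) (.inr hj)).contracted hj).gap_step_one (by omega)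

theorem gap_triple_two (hj : 6 * (j + 1) ≤ n) :
    0 < gap (opinion n (5 * (j + 1))) (3 * j + 2) ∧
      gap (opinion n (5 * (j + 1))) (3 * j + 2) ≤ 1 := by
  have h := (phase le_rfl (by omega) (.inr hj)).contracted hj
  have h₁ := h.gap_le 1 le_rfl (by omega)
  have h₂ := h.gap_le 2 (by omega) (by omega)
  have h₃ := h.gap_le 3 (by omega) (by omega)
  have h₄ := h.lt_gap_add 2 le_rfl (by omega)
  have p₁ := gap_nonneg h.reg.mono (p := 3 * j + 1) (by omega)
  have p₂ := gap_nonneg h.reg.mono (p := 3 * j + 2) (by omega)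
  rw [show 5 * (j + 1) = 5 * j + 4 + 1 by omega, opinion_succ, h.gap_step_two (by omega)]
  rw [show 3 * j + 2 + 1 = 3 * j + 3 by omega] at h₄
  constructor <;> linarith

theorem agreeOn_leftTriple (hj : 6 * (j + 1) ≤ n) (ht : 5 * (j + 1) + 1 ≤ t) :
    AgreeOn (opinion n t) (leftTriple n j) := by
  have ha := cut_left (n := n) (j := j) (t := 5 * (j + 1)) (by omega) (by omega)
  have hb := cut_left (n := n) (j := j + 1) (t := 5 * (j + 1)) hj (by omega)
  have h₁ := gap_triple_one hj
  have h₂ := (gap_triple_two hj).2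
  refine AgreeOn.opinion ht (by omega) (by omega) (ha.opinion (by omega) (by omega))
    (hb.opinion (by omega) (by omega)) ?_
  rw [opinion_succ]
  refine collapse (regular_opinion _ _).mono (by omega) ha hb ?_
  have e : 3 * j + 2 - 1 = 3 * j + 1 := rfl
  have e' : 3 * j + 3 - 1 = 3 * j + 2 := rfl
  simp only [gap, Nat.add_sub_cancel, e] at h₁ h₂
  rw [e']
  linarith

theorem agreeOn_rightTriple (hj : 6 * (j + 1) ≤ n) (ht : 5 * (j + 1) + 1 ≤ t) :
    AgreeOn (opinion n t) (rightTriple n j) :=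
  (agreeOn_leftTriple hj ht).symm (regular_opinion n t)

theorem gap_triple_le_one (hj : 6 * (j + 1) ≤ n) (ht : 5 * (j + 1) ≤ t) (p : ℕ)
    (hp : 3 * j < p) (hp' : p < 3 * j + 3) : gap (opinion n t) p ≤ 1 := by
  rcases ht.eq_or_lt with rfl | ht
  · rcases (by omega : p = 3 * j + 1 ∨ p = 3 * j + 2) with rfl | rfl
    · rw [gap_triple_one hj]
      exact zero_le_one
    · exact (gap_triple_two hj).2
  · rw [(agreeOn_leftTriple hj ht).gap_eq_zero (by omega) hp hp']
    exact zero_le_one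

theorem isComponent_leftTriple (hj : 6 * (j + 1) ≤ n) (ht : 5 * (j + 1) ≤ t) :
    IsComponent (opinion n t) (leftTriple n j) :=
  isComponent_block (regular_opinion n t).mono (by omega) (by omega)
    (cut_left (by omega) (by omega)) (cut_left (j := j + 1) hj ht) (gap_triple_le_one hj ht)

theorem isComponent_rightTriple (hj : 6 * (j + 1) ≤ n) (ht : 5 * (j + 1) ≤ t) :
    IsComponent (opinion n t) (rightTriple n j) :=
  isComponent_symm (regular_opinion n t) (by omega) (by omega)
    (cut_left (by omega) (by omega)) (cut_left (j := j + 1) hj ht) (gap_triple_le_one hj ht)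

theorem isCluster_leftTriple (hj : 6 * (j + 1) ≤ n) (ht : 5 * (j + 1) + 1 ≤ t) :
    IsCluster (opinion n t) (leftTriple n j) :=
  isCluster_block (regular_opinion n t).mono (by omega) (by omega)
    (cut_left (by omega) (by omega)) (cut_left (j := j + 1) hj (by omega))
    (agreeOn_leftTriple hj ht)

theorem isCluster_rightTriple (hj : 6 * (j + 1) ≤ n) (ht : 5 * (j + 1) + 1 ≤ t) :
    IsCluster (opinion n t) (rightTriple n j) :=
  isCluster_block (regular_opinion n t).mono (by omega) (by omega)
    (cut_right (j := j + 1) hj (by omega)) (cut_right (by omega) (by omega))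
    (agreeOn_rightTriple hj ht)

theorem not_isCluster_leftTriple (hj : 6 * (j + 1) ≤ n) :
    ¬ IsCluster (opinion n (5 * (j + 1))) (leftTriple n j) := fun h =>
  (gap_triple_two hj).1.ne' (AgreeOn.gap_eq_zero (a := 3 * j) (b := 3 * j + 3) (by omega) h.1
    (by omega) (by omega))

theorem not_isCluster_rightTriple (hj : 6 * (j + 1) ≤ n) :
    ¬ IsCluster (opinion n (5 * (j + 1))) (rightTriple n j) := fun h => by
  have h' := AgreeOn.symm (p := n - (3 * j + 3)) (q := n - 3 * j) (regular_opinion n _) h.1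
  refine (gap_triple_two hj).1.ne' (h'.gap_eq_zero (by omega) ?_ ?_) <;> omega

theorem isComponent_middle (hj : 6 * (j + 1) ≤ n) (ht : 5 * j ≤ t) (ht' : t < 5 * (j + 1)) :
    IsComponent (opinion n t) (middle n j) := by
  obtain ⟨s, rfl⟩ := Nat.exists_eq_add_of_le ht
  refine isComponent_block (regular_opinion n _).mono (by omega) (by omega)
    (cut_left (by omega) ht) (cut_right (by omega) ht) fun p hp hp' => ?_
  obtain ⟨i, rfl⟩ := Nat.exists_eq_add_of_lt hp
  have h : Phase n j s := phase (by omega) (by omega) (.inr hj)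
  exact h.bounds.gap_le_one (isProfile_upper s) (i := i + 1) (by omega) (by omega)

end Triples

theorem one_le_eps (l : ℕ) : 1 ≤ eps l := by
  unfold eps
  split_ifs <;> omega

theorem agreeOn_middle {n k l t : ℕ} (hn : n = 6 * k + l) (hl : l ≤ 5) (ht : 5 * k + eps l ≤ t) :
    AgreeOn (opinion n t) (middle n k) := by
  have he := one_le_eps l
  by_cases hl' : 2 ≤ l
  · have h := ((phase (s := 0) (by omega) (by omega) (.inl rfl)).collapses hn hl' hl).agree
    refine AgreeOn.opinion ht (by omega) (by omega) (cut_left (by omega) (by omega))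
      (cut_right (by omega) (by omega)) ?_
    rw [show n - 3 * k = 3 * k + l by omega, opinion, add_comm (5 * k), Function.iterate_add_apply]
    rwa [show eps l - 1 + 1 = eps l by omega] at h
  · intro i hi j hj
    rw [middle, mem_block] at hi hj
    rw [show i = j by ext; omega]

theorem isComponent_middle_final {n k l t : ℕ} (hn : n = 6 * k + l) (hl : l ≤ 5) (hl' : 0 < l)
    (ht : 5 * k ≤ t) : IsComponent (opinion n t) (middle n k) := by
  refine isComponent_block (regular_opinion n _).mono (by omega) (by omega)
    (cut_left (by omega) ht) (cut_right (by omega) ht) fun p hp hp' => ?_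
  by_cases ht' : 5 * k + eps l ≤ t
  · rw [(agreeOn_middle hn hl ht').gap_eq_zero (by omega) hp hp']
    exact zero_le_one
  · have h := ((phase (s := 0) (by omega) (by omega) (.inl rfl)).collapses hn
      (by omega) hl).gap_le (t - 5 * k) (by omega) (p - 3 * k) (by omega) (by omega)
    rw [opinion, ← Function.iterate_add_apply, show t - 5 * k + 5 * k = t by omega,
      show 3 * k + (p - 3 * k) = p by omega] at h
    exact h

theorem isCluster_middle {n k l t : ℕ} (hn : n = 6 * k + l) (hl : l ≤ 5) (hl' : 0 < l)
    (ht : 5 * k + eps l ≤ t) : IsCluster (opinion n t) (middle n k) :=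
  isCluster_block (regular_opinion n t).mono (by omega) (by omega) (cut_left (by omega) (by omega))
    (cut_right (by omega) (by omega)) (agreeOn_middle hn hl ht)

/-! ### The final configuration -/

theorem isCluster_of_mem_endTriples {n k t : ℕ} (hk : 6 * k ≤ n) (ht : 5 * k + 1 ≤ t)
    {S : Finset (Fin n)} (hS : S ∈ endTriples n k) : IsCluster (opinion n t) S := by
  simp only [endTriples, Finset.mem_union, Finset.mem_image, Finset.mem_range] at hS
  rcases hS with ⟨j, hj, rfl⟩ | ⟨j, hj, rfl⟩
  · exact isCluster_leftTriple (by omega) (by omega)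
  · exact isCluster_rightTriple (by omega) (by omega)

theorem exists_mem_endTriples_or_mem_middle (n k : ℕ) (hk : 6 * k ≤ n) (i : Fin n) :
    (∃ S ∈ endTriples n k, i ∈ S) ∨ i ∈ middle n k := by
  have hi := i.isLt
  simp only [endTriples, Finset.mem_union, Finset.mem_image, Finset.mem_range]
  rcases (by omega : i.val < 3 * k ∨ n - 3 * k ≤ i.val ∨ 3 * k ≤ i.val ∧ i.val < n - 3 * k) with
    h | h | h
  · refine .inl ⟨_, .inl ⟨i.val / 3, by omega, rfl⟩, ?_⟩
    rw [leftTriple, mem_block]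
    omega
  · refine .inl ⟨_, .inr ⟨(n - 1 - i.val) / 3, by omega, rfl⟩, ?_⟩
    rw [rightTriple, mem_block]
    omega
  · exact .inr (mem_block.2 h)

theorem isCluster_iff {n k l : ℕ} (hn : 0 < n) (hnkl : n = 6 * k + l) (hl : l ≤ 5)
    (S : Finset (Fin n)) : IsCluster (opinion n (5 * k + eps l)) S ↔
      S ∈ endTriples n k ∨ (0 < l ∧ S = middle n k) := by
  have he := one_le_eps l
  constructor
  · intro hS
    obtain ⟨i, hi⟩ := hS.nonempty hn
    rcases exists_mem_endTriples_or_mem_middle n k (by omega) i with ⟨T, hT, hiT⟩ | hi'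
    · have := isCluster_of_mem_endTriples (t := 5 * k + eps l) (by omega) (by omega) hT
      rw [hS.eq_of_mem this hi hiT]
      exact .inl hT
    · have hl' : 0 < l := by
        rw [middle, mem_block] at hi'
        omega
      exact .inr ⟨hl', hS.eq_of_mem (isCluster_middle hnkl hl hl' le_rfl) hi hi'⟩
  · rintro (hS | ⟨hl', rfl⟩)
    · exact isCluster_of_mem_endTriples (by omega) (by omega) hS
    · exact isCluster_middle hnkl hl hl' le_rfl

theorem frozen_of_blocks {n : ℕ} {x : Fin n → ℝ} (hx : Monotone x)
    (h : ∀ i : Fin n, ∃ p q, i ∈ block n p q ∧ Cut x p ∧ Cut x q ∧ AgreeOn x (block n p q)) :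
    Frozen x := by
  intro i j hij
  obtain ⟨p, q, hi, hp, hq, hpq⟩ := h i
  have hj : j ∉ block n p q := fun hj => hij (hpq i hi j hj)
  rw [mem_block] at hi hj
  rcases (by omega : j.val < p ∨ q ≤ j.val) with hj | hj
  · exact (hp.lt hx hj hi.1).trans_le (le_abs_self _)
  · rw [abs_sub_comm]
    exact (hq.lt hx hi.2 hj).trans_le (le_abs_self _)

theorem frozen_final {n k l : ℕ} (hn : n = 6 * k + l) (hl : l ≤ 5) :
    Frozen (opinion n (5 * k + eps l)) := by
  have he := one_le_eps l
  refine frozen_of_blocks (regular_opinion n _).mono fun i => ?_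
  rcases exists_mem_endTriples_or_mem_middle n k (by omega) i with ⟨S, hS, hi⟩ | hi
  · simp only [endTriples, Finset.mem_union, Finset.mem_image, Finset.mem_range] at hS
    rcases hS with ⟨j, hj, rfl⟩ | ⟨j, hj, rfl⟩
    · exact ⟨_, _, hi, cut_left (by omega) (by omega),
        cut_left (j := j + 1) (by omega) (by omega), agreeOn_leftTriple (by omega) (by omega)⟩
    · exact ⟨_, _, hi, cut_right (j := j + 1) (by omega) (by omega),
        cut_right (by omega) (by omega), agreeOn_rightTriple (by omega) (by omega)⟩
  · exact ⟨_, _, hi, cut_left (by omega) (by omega), cut_right (by omega) (by omega),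
      agreeOn_middle hn hl le_rfl⟩

theorem not_frozen_before_final {n k l : ℕ} (hn : 2 ≤ n) (hnkl : n = 6 * k + l) (hl : l ≤ 5) :
    ¬ Frozen (opinion n (5 * k + (eps l - 1))) := by
  by_cases hl' : 2 ≤ l
  · have h := (phase (s := 0) (by omega) (by omega) (.inl rfl)).collapses hnkl hl' hl
    obtain ⟨i, hi, hil, hpos⟩ := h.gap_pos
    have hle := h.gap_le _ le_rfl i hi hil
    rw [opinion, ← Function.iterate_add_apply, add_comm] at hpos hle
    exact not_frozen_of_gap (by omega) hpos hle
  · -- the outcome is decided by the last triples that were shed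
    obtain ⟨j, rfl⟩ : ∃ j, k = j + 1 := ⟨k - 1, by omega⟩
    have he : eps l - 1 = 0 := by
      rcases (by omega : l = 0 ∨ l = 1) with rfl | rfl <;> rfl
    obtain ⟨hpos, hle⟩ := gap_triple_two (n := n) (j := j) (by omega)
    rw [he]
    exact not_frozen_of_gap (by omega) hpos hle

theorem card_endTriples {n k : ℕ} (hk : 6 * k ≤ n) : (endTriples n k).card = 2 * k := by
  have hmem : ∀ j < k, ∀ p q, block n (3 * j) (3 * j + 3) = block n p q →
      p ≤ 3 * j ∧ 3 * j < q := by
    intro j hj p q h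
    have : (⟨3 * j, by omega⟩ : Fin n) ∈ block n p q := h ▸ mem_block.2 ⟨le_rfl, by simp⟩
    exact mem_block.1 this
  have hmem' : ∀ j < k, ∀ p q, block n (n - (3 * j + 3)) (n - 3 * j) = block n p q →
      p ≤ n - 3 * j - 1 ∧ n - 3 * j - 1 < q := by
    intro j hj p q h
    have : (⟨n - 3 * j - 1, by omega⟩ : Fin n) ∈ block n p q :=
      h ▸ mem_block.2 ⟨by simp only; omega, by simp only; omega⟩
    exact mem_block.1 this
  rw [endTriples, Finset.card_union_of_disjoint, Finset.card_image_of_injOn,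
    Finset.card_image_of_injOn, Finset.card_range, two_mul]
  · intro i hi j hj hij
    rw [Finset.coe_range, Set.mem_Iio] at hi hj
    have := hmem' i hi _ _ hij
    omega
  · intro i hi j hj hij
    rw [Finset.coe_range, Set.mem_Iio] at hi hj
    have := hmem i hi _ _ hij
    omega
  · rw [Finset.disjoint_left]
    intro S hS hS'
    simp only [Finset.mem_image, Finset.mem_range] at hS hS'
    obtain ⟨i, hi, rfl⟩ := hS
    obtain ⟨j, hj, hij⟩ := hS'
    have := hmem i hi _ _ hij.symm
    omega

theorem card_of_mem_endTriples {n k : ℕ} (hk : 6 * k ≤ n) {S : Finset (Fin n)}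
    (hS : S ∈ endTriples n k) : S.card = 3 := by
  simp only [endTriples, Finset.mem_union, Finset.mem_image, Finset.mem_range] at hS
  rcases hS with ⟨j, hj, rfl⟩ | ⟨j, hj, rfl⟩
  · rw [leftTriple, card_block (by omega)]
    omega
  · rw [rightTriple, card_block (by omega)]
    omega

theorem opinion_middle {n k l : ℕ} (hn : n = 6 * k + l) (hl : l ≤ 5) {i : Fin n}
    (hi : i ∈ middle n k) : opinion n (5 * k + eps l) i = ((n : ℝ) + 1) / 2 := by
  have hi' : i.rev ∈ middle n k := by
    rw [middle, mem_block] at hi ⊢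
    rw [Fin.val_rev]
    omega
  have h₁ := agreeOn_middle hn hl le_rfl i hi _ hi'
  have h₂ := (regular_opinion n (5 * k + eps l)).symm i
  linarith

end HK

theorem theorem1 (n k l : ℕ) (hn : 2 ≤ n) (hnkl : n = 6 * k + l) (hl : l ≤ 5) :
    -- (i) three agents disconnect at each end at every fifth time step, and collapse one step later
    ((∀ j : ℕ, j < k →
        (∀ t : ℕ, 5 * j ≤ t → t < 5 * (j + 1) →
          HK.IsComponent (HK.opinion n t) (HK.middle n j)) ∧
        (∀ t : ℕ, 5 * (j + 1) ≤ t →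
          HK.IsComponent (HK.opinion n t) (HK.leftTriple n j) ∧
          HK.IsComponent (HK.opinion n t) (HK.rightTriple n j)) ∧
        (¬ HK.IsCluster (HK.opinion n (5 * (j + 1))) (HK.leftTriple n j) ∧
          ¬ HK.IsCluster (HK.opinion n (5 * (j + 1))) (HK.rightTriple n j)) ∧
        (HK.IsCluster (HK.opinion n (5 * (j + 1) + 1)) (HK.leftTriple n j) ∧
          HK.IsCluster (HK.opinion n (5 * (j + 1) + 1)) (HK.rightTriple n j))) ∧
      (0 < l → ∀ t : ℕ, 5 * k ≤ t → HK.IsComponent (HK.opinion n t) (HK.middle n k))) ∧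
    -- (ii) the final configuration
    ((∀ t : ℕ, 5 * k + HK.eps l ≤ t → HK.opinion n t = HK.opinion n (5 * k + HK.eps l)) ∧
      (HK.endTriples n k).card = 2 * k ∧
      (∀ S ∈ HK.endTriples n k, S.card = 3) ∧
      (HK.middle n k).card = l ∧
      (∀ S : Finset (Fin n), HK.IsCluster (HK.opinion n (5 * k + HK.eps l)) S ↔
        S ∈ HK.endTriples n k ∨ (0 < l ∧ S = HK.middle n k)) ∧
      (∀ i : Fin n, HK.opinion n (5 * k + HK.eps l) i +
        HK.opinion n (5 * k + HK.eps l) i.rev = (n : ℝ) + 1) ∧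
      (∀ i ∈ HK.middle n k, HK.opinion n (5 * k + HK.eps l) i = ((n : ℝ) + 1) / 2)) ∧
    -- (iii) the freezing time
    IsLeast {t : ℕ | HK.Frozen (HK.opinion n t)} (5 * k + HK.eps l) := by
  have he := HK.one_le_eps l
  have hfrozen := HK.frozen_final hnkl hl
  refine ⟨⟨fun j hj => ?_, fun hl' t ht => HK.isComponent_middle_final hnkl hl hl' ht⟩,
    ⟨fun t ht => hfrozen.opinion_eq ht, HK.card_endTriples (by omega),
      fun S hS => HK.card_of_mem_endTriples (by omega) hS, ?_,
      HK.isCluster_iff (by omega) hnkl hl, (HK.regular_opinion n _).symm,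
      fun i hi => HK.opinion_middle hnkl hl hi⟩, hfrozen, fun t ht => ?_⟩
  · have hj' : 6 * (j + 1) ≤ n := by omega
    exact ⟨fun t ht ht' => HK.isComponent_middle hj' ht ht',
      fun t ht => ⟨HK.isComponent_leftTriple hj' ht, HK.isComponent_rightTriple hj' ht⟩,
      ⟨HK.not_isCluster_leftTriple hj', HK.not_isCluster_rightTriple hj'⟩,
      ⟨HK.isCluster_leftTriple hj' le_rfl, HK.isCluster_rightTriple hj' le_rfl⟩⟩
  · rw [HK.middle, HK.card_block (by omega)]
    omega
  · -- a frozen configuration stays as it is, so the last time before the claimed one suffices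
    by_contra! hlt
    have h : HK.Frozen (HK.opinion n t) := ht
    refine HK.not_frozen_before_final hn hnkl hl ?_
    rwa [h.opinion_eq (by omega)]
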